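/- **Theorem 1.5.** There is a subcubic reduction from $\mathsf{CoNegativeTriangle}$ to $\mathsf{NegativeTriangle}$, that is, $\mathsf{CoNegativeTriangle}\le_{n^3}\mathsf{NegativeTriangle}$. The notions are the following. *Inputs.* A graph $G$ is a finite directed graph without loops on $n$ vertices with integer edge weights, given by its weight matrix; a pair without an edge has weight $\infty$. Weights are polynomially bounded: for some constant $c$ they lie in $[-n^c,n^c]\cup\{\infty\}$. A vertex $v$ is in a negative triangle if there are vertices $a,b$ with $v,a,b$ pairwise distinct and $w(v,a)+w(a,b)+w(b,v)<0$. *Problems.* $\mathsf{NegativeTriangle}$: decide whether $G$ has a negative triangle. $\mathsf{CoNegativeTriangle}$: either report that every vertex of $G$ is in a negative triangle, or return a vertex of $G$ that is not in any negative triangle. *Computation.* Programs run on a deterministic word RAM whose words have $O(\log n)$ bits (they hold the integers of absolute value at most $(n+2)^K$ for a constant $K$); arithmetic operations $+,-,\times$, integer division, memory accesses and comparisons take one step each. A program may call a black box on a graph that it has stored in memory as a weight matrix; a call on a graph with $m$ vertices costs the running time of the black box on it plus $2m^2+2$ steps for handing over the matrix. *Subcubic reduction.* There is one program $P$ such that for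 every $c$ there are $c'$ and $K$ such that for every $\varepsilon>0$ there is $\delta>0$ with the following property: for every deterministic black box $Q$ that solves $\mathsf{NegativeTriangle}$ in time $O(m^{3-\varepsilon})$ on graphs with $m$ vertices and weights in $[-m^{c'},m^{c'}]\cup\{\infty\}$, the program $P$ with black box $Q$ and word size given by $K$ solves $\mathsf{CoNegativeTriangle}$ in time $O(n^{3-\delta})$, including the time taken by $Q$, on graphs with $n$ vertices and weights in $[-n^c,n^c]\cup\{\infty\}$. (The bounds are read with $m+1$ and $n+1$ in place of $m$ and $n$, which only matters for the empty graph.) -/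

import Mathlib

namespace Subcubic

/-! ### Weighted directed graphs and the two problems -/

/-- A finite weighted directed graph without loops, on the vertex set `Fin n`. The value `⊤`
(that is, `∞`) means that there is no edge; every other weight is an integer. -/
structure WGraph where
  n : ℕ
  w : Fin n → Fin n → WithTop ℤ
  loopless : ∀ i, w i i = ⊤

namespace WGraph

/-- All edge weights of `G` lie in `[-M, M]`. -/
def WeightsBounded (G : WGraph) (M : ℕ) : Prop :=
  ∀ i j : Fin G.n, ∀ x : ℤ, G.w i j = (x : WithTop ℤ) → |x| ≤ (M : ℤ)

/-- The vertex `v` lies in a (directed) triangle `v → a → b → v` of negative total weight. -/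
def InNegativeTriangle (G : WGraph) (v : Fin G.n) : Prop :=
  ∃ a b : Fin G.n, v ≠ a ∧ a ≠ b ∧ b ≠ v ∧ G.w v a + G.w a b + G.w b v < 0

end WGraph

/-- A computational problem on weighted digraphs: `A G z` says that the integer `z` is an
acceptable answer on the input `G`. -/
abbrev GraphProblem := WGraph → ℤ → Prop

/-- Decide whether `G` has a negative triangle (`1` is YES, `0` is NO). -/
def NegativeTriangle : GraphProblem := fun G z =>
  (z = 1 ∧ ∃ v, G.InNegativeTriangle v) ∨ (z = 0 ∧ ¬ ∃ v, G.InNegativeTriangle v)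

/-- Either report (by the answer `-1`) that every vertex of `G` is in a negative triangle, or
return a vertex that is not in any negative triangle. -/
def CoNegativeTriangle : GraphProblem := fun G z =>
  (z = -1 ∧ ∀ v, G.InNegativeTriangle v) ∨
    ∃ v : Fin G.n, z = ((v : ℕ) : ℤ) ∧ ¬ G.InNegativeTriangle v

/-! ### The word RAM with calls to a black box -/

/-- The arithmetic operations; each takes one time unit. -/
inductive Op
  | add | sub | mul | div

/-- `div` is integer division, with value `0` when the divisor is `0`. -/
def Op.eval : Op → ℤ → ℤ → ℤ
  | .add, x, y => x + y
  | .sub, x, y => x - y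
  | .mul, x, y => x * y
  | .div, x, y => x / y

/-- Programs of a random access machine. The arguments of type `ℕ` are names of registers. -/
inductive Cmd
  /-- do nothing -/
  | skip
  /-- `r := k` -/
  | const (r : ℕ) (k : ℤ)
  /-- `r := a o b` -/
  | op (o : Op) (r a b : ℕ)
  /-- `r := mem[a]` -/
  | load (r a : ℕ)
  /-- `mem[a] := b` -/
  | store (a b : ℕ)
  | seq (p q : Cmd)
  /-- `if a < b then p else q` -/
  | ifLt (a b : ℕ) (p q : Cmd)
  /-- `while a < b do p` -/
  | whileLt (a b : ℕ) (p : Cmd)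
  /-- `r :=` the answer of the black box on the graph with `m` vertices stored at address `a` -/
  | call (r m a : ℕ)

/-- A state of the machine: the contents of the registers and of the memory. -/
structure State where
  reg : ℕ → ℤ
  mem : ℤ → ℤ

def State.setReg (s : State) (r : ℕ) (x : ℤ) : State :=
  { s with reg := Function.update s.reg r x }

def State.setMem (s : State) (a x : ℤ) : State :=
  { s with mem := Function.update s.mem a x }

/-- An entry of the weight matrix occupies two words. The first tells whether there is an edge. -/
def edgeFlag (e : WithTop ℤ) : ℤ := if e = ⊤ then 0 else 1

/-- The second word is the weight of the edge (`0` if there is no edge). -/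
def edgeWeight (e : WithTop ℤ) : ℤ := WithTop.untopD 0 e

/-- The weight matrix of `G` is stored row by row in `mem`, from address `base` on. -/
def Stores (mem : ℤ → ℤ) (base : ℤ) (G : WGraph) : Prop :=
  ∀ i j : Fin G.n,
    mem (base + 2 * ((i : ℤ) * G.n + j)) = edgeFlag (G.w i j) ∧
    mem (base + 2 * ((i : ℤ) * G.n + j) + 1) = edgeWeight (G.w i j)

/-- The input-output behaviour of an algorithm on graphs: `R G t z` says that on the input `G` it
halts after `t` steps with the answer `z`. -/
abbrev Behaviour := WGraph → ℕ → ℤ → Prop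

/-- On every input there is at most one outcome. -/
def Behaviour.Deterministic (R : Behaviour) : Prop :=
  ∀ G t z t' z', R G t z → R G t' z' → t = t' ∧ z = z'

/-- `Exec W box p s t s'`: with words in `[-W, W]` and the black box `box`, the program `p`, started
in the state `s`, halts in the state `s'` after `t` steps. The machine is stuck when a value does not
fit into a word. Elementary instructions and tests take one step. A call takes the time of the black
box on the query, and in addition time for handing over the weight matrix of the query. -/
inductive Exec (W : ℕ) (box : Behaviour) : Cmd → State → ℕ → State → Prop
  | skip (s : State) : Exec W box .skip s 1 s
  | const (s : State) (r : ℕ) (k : ℤ) (hk : |k| ≤ (W : ℤ)) :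
      Exec W box (.const r k) s 1 (s.setReg r k)
  | op (s : State) (o : Op) (r a b : ℕ) (h : |o.eval (s.reg a) (s.reg b)| ≤ (W : ℤ)) :
      Exec W box (.op o r a b) s 1 (s.setReg r (o.eval (s.reg a) (s.reg b)))
  | load (s : State) (r a : ℕ) (h : |s.mem (s.reg a)| ≤ (W : ℤ)) :
      Exec W box (.load r a) s 1 (s.setReg r (s.mem (s.reg a)))
  | store (s : State) (a b : ℕ) :
      Exec W box (.store a b) s 1 (s.setMem (s.reg a) (s.reg b))
  | seq {p q : Cmd} {s s' s'' : State} {t t' : ℕ}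
      (hp : Exec W box p s t s') (hq : Exec W box q s' t' s'') :
      Exec W box (.seq p q) s (t + t') s''
  | ifLt_true {a b : ℕ} {p q : Cmd} {s s' : State} {t : ℕ} (h : s.reg a < s.reg b)
      (hp : Exec W box p s t s') : Exec W box (.ifLt a b p q) s (t + 1) s'
  | ifLt_false {a b : ℕ} {p q : Cmd} {s s' : State} {t : ℕ} (h : ¬ s.reg a < s.reg b)
      (hq : Exec W box q s t s') : Exec W box (.ifLt a b p q) s (t + 1) s'
  | while_false {a b : ℕ} {p : Cmd} {s : State} (h : ¬ s.reg a < s.reg b) :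
      Exec W box (.whileLt a b p) s 1 s
  | while_true {a b : ℕ} {p : Cmd} {s s' s'' : State} {t t' : ℕ} (h : s.reg a < s.reg b)
      (hp : Exec W box p s t s') (hw : Exec W box (.whileLt a b p) s' t' s'') :
      Exec W box (.whileLt a b p) s (t + t' + 1) s''
  | call (s : State) (r m a : ℕ) (G : WGraph) (t : ℕ) (z : ℤ)
      (hm : s.reg m = (G.n : ℤ)) (hG : Stores s.mem (s.reg a) G)
      (hbox : box G t z) (hz : |z| ≤ (W : ℤ)) :
      Exec W box (.call r m a) s (t + 2 * G.n ^ 2 + 2) (s.setReg r z)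

/-- The entries of the weight matrix of `G`, with `⊤` outside of the matrix. -/
def WGraph.entry (G : WGraph) (i j : ℕ) : WithTop ℤ :=
  if h : i < G.n ∧ j < G.n then G.w ⟨i, h.1⟩ ⟨j, h.2⟩ else ⊤

/-- The memory on input `G`: the weight matrix from address `0` on, and `0` elsewhere. -/
def WGraph.initMem (G : WGraph) (a : ℤ) : ℤ :=
  if a < 0 then 0
  else if a % 2 = 0 then edgeFlag (G.entry (a.toNat / 2 / G.n) (a.toNat / 2 % G.n))
  else edgeWeight (G.entry (a.toNat / 2 / G.n) (a.toNat / 2 % G.n))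

/-- The initial state on input `G`: register `0` holds the number of vertices, the other registers
hold `0`, and the memory holds the weight matrix. -/
def WGraph.initState (G : WGraph) : State where
  reg := fun r => if r = 0 then (G.n : ℤ) else 0
  mem := G.initMem

theorem WGraph.initState_stores (G : WGraph) : Stores G.initState.mem 0 G := by
  intro i j
  have hn : 0 < G.n := i.pos
  have h1 : ((i : ℕ) * G.n + j) / G.n = i := by
    rw [mul_comm, Nat.mul_add_div hn, Nat.div_eq_of_lt j.2, add_zero]
  have h2 : ((i : ℕ) * G.n + j) % G.n = j := by
    rw [mul_comm, Nat.mul_add_mod, Nat.mod_eq_of_lt j.2]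
  have e : (0 : ℤ) + 2 * ((i : ℤ) * G.n + j) = ((2 * ((i : ℕ) * G.n + j) : ℕ) : ℤ) := by
    push_cast; ring
  have key : G.entry i j = G.w i j := by simp [WGraph.entry]
  rw [e]
  generalize hk : (i : ℕ) * G.n + j = k at *
  constructor
  · have a1 : ¬ (((2 * k : ℕ) : ℤ) < 0) := by omega
    have a2 : ((2 * k : ℕ) : ℤ) % 2 = 0 := by omega
    have a3 : (((2 * k : ℕ) : ℤ)).toNat / 2 = k := by omega
    simp only [WGraph.initState, WGraph.initMem, if_neg a1, if_pos a2, a3, h1, h2, key]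
  · have a1 : ¬ (((2 * k : ℕ) : ℤ) + 1 < 0) := by omega
    have a2 : ¬ (((2 * k : ℕ) : ℤ) + 1) % 2 = 0 := by omega
    have a3 : (((2 * k : ℕ) : ℤ) + 1).toNat / 2 = k := by omega
    simp only [WGraph.initState, WGraph.initMem, if_neg a1, if_neg a2, a3, h1, h2, key]

/-- The behaviour of the program `p` with the black box `box`, on a machine whose words hold the
integers of absolute value at most `(n + 2) ^ K` when the input has `n` vertices (words of `O(log n)`
bits). The answer is read off register `0`. -/
def Cmd.behaviour (p : Cmd) (K : ℕ) (box : Behaviour) : Behaviour := fun G t z =>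
  ∃ s : State, Exec ((G.n + 2) ^ K) box p G.initState t s ∧ s.reg 0 = z

/-! ### Subcubic time and subcubic reductions -/

/-- `R` solves the problem `A` in time `O(n ^ e)` on the graphs with `n` vertices whose weights are
integers in `[-n ^ c, n ^ c]`. (`n + 1` instead of `n` only matters for the empty graph.) -/
def Behaviour.SolvesInTime (R : Behaviour) (A : GraphProblem) (c : ℕ) (e : ℝ) : Prop :=
  ∃ C : ℝ, ∀ G : WGraph, G.WeightsBounded (G.n ^ c) →
    ∃ t z, R G t z ∧ A G z ∧ (t : ℝ) ≤ C * ((G.n : ℝ) + 1) ^ e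

/-- There is a subcubic reduction from `A` to `B`: there is a program `p` that, for all polynomially
bounded weights, solves `A` in time `O(n ^ (3 - δ))` when it is given any black box that solves `B`
in time `O(n ^ (3 - ε))`, where `δ > 0` may depend on `ε > 0`. The program has no access to the black
box other than through calls, and the time that the black box takes is part of the running time. -/
def SubcubicReduction (A B : GraphProblem) : Prop :=
  ∃ p : Cmd, ∀ c : ℕ, ∃ c' K : ℕ, ∀ ε : ℝ, 0 < ε → ∃ δ : ℝ, 0 < δ ∧
    ∀ box : Behaviour, box.Deterministic → box.SolvesInTime B c' (3 - ε) →
      (p.behaviour K box).SolvesInTime A c (3 - δ)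

/-! ### Consequence for algorithms without black boxes -/

theorem WGraph.eq_of_stores {mem : ℤ → ℤ} {base : ℤ} {G H : WGraph} (hn : G.n = H.n)
    (hG : Stores mem base G) (hH : Stores mem base H) : G = H := by
  obtain ⟨n, w, hw⟩ := G
  obtain ⟨m, v, hv⟩ := H
  obtain rfl : n = m := hn
  have : w = v := by
    funext i j
    have h1 := hG i j
    have h2 := hH i j
    dsimp only at h1 h2
    have e1 := h1.1.symm.trans h2.1
    have e2 := h1.2.symm.trans h2.2
    generalize w i j = x at e1 e2
    generalize v i j = y at e1 e2
    cases x <;> cases y <;> simp_all [edgeFlag, edgeWeight]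
  subst this
  rfl

/-- Executions are unique, so that "there is a run with these properties" is not ambiguous. -/
theorem Exec.unique {W : ℕ} {box : Behaviour} (hd : box.Deterministic) {p : Cmd} {s : State}
    {t t' : ℕ} {u u' : State} (h : Exec W box p s t u) (h' : Exec W box p s t' u') :
    t = t' ∧ u = u' := by
  induction h generalizing t' u' with
  | skip => cases h'; exact ⟨rfl, rfl⟩
  | const => cases h'; exact ⟨rfl, rfl⟩
  | op => cases h'; exact ⟨rfl, rfl⟩
  | load => cases h'; exact ⟨rfl, rfl⟩
  | store => cases h'; exact ⟨rfl, rfl⟩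
  | seq _ _ ih1 ih2 =>
    cases h' with
    | seq k1 k2 =>
      obtain ⟨rfl, rfl⟩ := ih1 k1
      obtain ⟨rfl, rfl⟩ := ih2 k2
      exact ⟨rfl, rfl⟩
  | ifLt_true h _ ih =>
    cases h' with
    | ifLt_true _ k => obtain ⟨rfl, rfl⟩ := ih k; exact ⟨rfl, rfl⟩
    | ifLt_false k _ => exact absurd h k
  | ifLt_false h _ ih =>
    cases h' with
    | ifLt_true k _ => exact absurd k h
    | ifLt_false _ k => obtain ⟨rfl, rfl⟩ := ih k; exact ⟨rfl, rfl⟩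
  | while_false h =>
    cases h' with
    | while_false => exact ⟨rfl, rfl⟩
    | while_true k _ _ => exact absurd k h
  | while_true h _ _ ih1 ih2 =>
    cases h' with
    | while_false k => exact absurd h k
    | while_true _ k1 k2 =>
      obtain ⟨rfl, rfl⟩ := ih1 k1
      obtain ⟨rfl, rfl⟩ := ih2 k2
      exact ⟨rfl, rfl⟩
  | call s r m a G t z hm hG hbox hz =>
    cases h' with
    | call _ _ _ _ H t2 z2 km kG kbox kz =>
      have hGH : G = H := WGraph.eq_of_stores (by exact_mod_cast hm.symm.trans km) hG kG
      subst hGH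
      obtain ⟨rfl, rfl⟩ := hd _ _ _ _ _ hbox kbox
      exact ⟨rfl, rfl⟩

theorem Cmd.behaviour_deterministic (p : Cmd) (K : ℕ) {box : Behaviour}
    (hd : box.Deterministic) : (p.behaviour K box).Deterministic := by
  rintro G t z t' z' ⟨s, hs, rfl⟩ ⟨s', hs', rfl⟩
  obtain ⟨rfl, rfl⟩ := hs.unique hd hs'
  exact ⟨rfl, rfl⟩

/-- An algorithm without black boxes: a program, with the exponent of its word size, followed by the
algorithm that it may call as a subroutine; the last program of the chain has nothing to call. -/
def algorithmBehaviour : List (Cmd × ℕ) → Behaviour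
  | [] => fun _ _ _ => False
  | (p, K) :: L => p.behaviour K (algorithmBehaviour L)

theorem algorithmBehaviour_deterministic :
    ∀ L : List (Cmd × ℕ), (algorithmBehaviour L).Deterministic
  | [] => fun _ _ _ _ _ h => h.elim
  | (p, K) :: L => p.behaviour_deterministic K (algorithmBehaviour_deterministic L)

/-- The problem `A` has a (truly) subcubic algorithm, for all polynomially bounded weights. -/
def HasSubcubicAlgorithm (A : GraphProblem) : Prop :=
  ∀ c : ℕ, ∃ L : List (Cmd × ℕ), ∃ ε : ℝ, 0 < ε ∧ (algorithmBehaviour L).SolvesInTime A c (3 - ε)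

/-- A subcubic reduction turns subcubic algorithms for `B` into subcubic algorithms for `A`. -/
theorem SubcubicReduction.hasSubcubicAlgorithm {A B : GraphProblem} (h : SubcubicReduction A B)
    (hB : HasSubcubicAlgorithm B) : HasSubcubicAlgorithm A := by
  intro c
  obtain ⟨p, hp⟩ := h
  obtain ⟨c', K, hK⟩ := hp c
  obtain ⟨L, ε, hε, hL⟩ := hB c'
  obtain ⟨δ, hδ, H⟩ := hK ε hε
  exact ⟨(p, K) :: L, δ, hδ, H _ (algorithmBehaviour_deterministic L) hL⟩

end Subcubic

/-! Let `S` be the least integer with `n ≤ S * S`, and cut the vertices into `S` blocks of `S`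
consecutive numbers; numbers from `n` on have no edges and do no harm. The corners of a triangle lie
in one of the `S ^ 3` ordered triples of blocks. For each triple, the query is a tripartite graph on
`3 * S` vertices whose edges lead from each part to the cyclically next one, and in which the
vertices of the first part that are already marked have lost their outgoing edges. A YES means that
some unmarked vertex of the first block is the first corner of a negative triangle in these blocks
(`queryGraph_exists_iff`). Only then are all `S ^ 3` choices of corners tried, and all first corners
found are marked. A NO means that nothing is left to mark.

Each YES marks a new vertex, so there are at most `n` exhaustive searches, although there are `S ^
3` queries; `runs_processBlock` expresses this with the number of marks as a potential, and
`runs_processBlocks` adds up. In the end the marked vertices are exactly those in negative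
triangles.

The searches take `O(n * S ^ 3)`, which is `O(S ^ 5)`, and so does the construction of the queries.
With `0 < e ≤ 1` and answers in time `O(S ^ (3 - e))`, the total is `O(S ^ (6 - e))`, that is, `O(n
^ (3 - e / 2))` because `S` is of order `√n` (`time_le_pow`, `time_le_rpow`).

For the machine model, terms are compiled to code (`Term.exec_comp`), and the rules for `Runs` form
a Hoare logic with running times. Stored values stay below a polynomial `X` in `n`; intermediate
values stay below a fixed power of `X`, which fits into a word. -/

namespace Subcubic

/-! ### A language of terms, compiled to the machine -/

/-- Terms over program variables and memory. The variable `r` lives in the register `2 * r`; the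
registers with odd numbers hold intermediate results. -/
inductive Term
  | var (r : ℕ)
  | lit (k : ℤ)
  | bin (o : Op) (a b : Term)
  /-- the contents of the memory at the address `a` -/
  | read (a : Term)
  /-- `p` if `a < b`, and `q` otherwise -/
  | ite (a b p q : Term)

namespace Term

instance : Add Term := ⟨.bin .add⟩
instance : Sub Term := ⟨.bin .sub⟩
instance : Mul Term := ⟨.bin .mul⟩
instance : Div Term := ⟨.bin .div⟩
-- The machine has no remainder instruction, so `a` and `b` are evaluated twice; this is also the
-- definition of `Int.emod` in terms of division.
instance : Mod Term := ⟨fun a b => a - b * (a / b)⟩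

def eval (s : State) : Term → ℤ
  | var r => s.reg r
  | lit k => k
  | bin o a b => o.eval (a.eval s) (b.eval s)
  | read a => s.mem (a.eval s)
  | ite a b p q => if a.eval s < b.eval s then p.eval s else q.eval s

section
variable (s : State) (a b : Term)

@[simp] theorem eval_var (r : ℕ) : (var r).eval s = s.reg r := rfl
@[simp] theorem eval_lit (k : ℤ) : (lit k).eval s = k := rfl
@[simp] theorem eval_add : (a + b).eval s = a.eval s + b.eval s := rfl
@[simp] theorem eval_sub : (a - b).eval s = a.eval s - b.eval s := rfl
@[simp] theorem eval_mul : (a * b).eval s = a.eval s * b.eval s := rfl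
@[simp] theorem eval_div : (a / b).eval s = a.eval s / b.eval s := rfl
@[simp] theorem eval_mod : (a % b).eval s = a.eval s % b.eval s := (Int.emod_def _ _).symm
@[simp] theorem eval_read : (read a).eval s = s.mem (a.eval s) := rfl
@[simp] theorem eval_ite (p q : Term) :
    (ite a b p q).eval s = if a.eval s < b.eval s then p.eval s else q.eval s := rfl

end

/-- If all variables and memory cells are at most `X ≥ 2` in absolute value, then all values that
arise in the evaluation are at most `X ^ deg`. -/
def deg : Term → ℕ
  | var _ => 1
  | lit k => k.natAbs + 1
  | bin _ a b => a.deg + b.deg + 1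
  | read a => a.deg + 1
  | ite a b p q => a.deg + b.deg + p.deg + q.deg

def cost : Term → ℕ
  | var _ => 2
  | lit _ => 1
  | bin _ a b => a.cost + b.cost + 1
  | read a => a.cost + 1
  | ite a b p q => a.cost + b.cost + p.cost + q.cost + 1

/-- Code that evaluates a term into the register `2 * t + 1`, with the odd registers from there on
as working space. -/
def comp : Term → ℕ → Cmd
  -- There is no instruction that copies a register, hence the addition to `0`.
  | var r, t => .seq (.const (2 * t + 1) 0) (.op .add (2 * t + 1) (2 * t + 1) (2 * r))
  | lit k, t => .const (2 * t + 1) k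
  | bin o a b, t =>
    .seq (a.comp t) (.seq (b.comp (t + 1)) (.op o (2 * t + 1) (2 * t + 1) (2 * (t + 1) + 1)))
  | read a, t => .seq (a.comp t) (.load (2 * t + 1) (2 * t + 1))
  | ite a b p q, t =>
    .seq (a.comp t) (.seq (b.comp (t + 1))
      (.ifLt (2 * t + 1) (2 * (t + 1) + 1) (p.comp t) (q.comp t)))

end Term

/-- All registers and memory cells hold integers of absolute value at most `X`. -/
def State.Bounded (X : ℕ) (s : State) : Prop :=
  (∀ r, |s.reg r| ≤ (X : ℤ)) ∧ ∀ a, |s.mem a| ≤ (X : ℤ)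

theorem State.Bounded.setReg {X : ℕ} {s : State} (h : s.Bounded X) (r : ℕ) {x : ℤ}
    (hx : |x| ≤ (X : ℤ)) : (s.setReg r x).Bounded X := by
  refine ⟨fun q => ?_, h.2⟩
  simp only [State.setReg, Function.update_apply]
  split_ifs
  exacts [hx, h.1 q]

theorem State.Bounded.setMem {X : ℕ} {s : State} (h : s.Bounded X) (a : ℤ) {x : ℤ}
    (hx : |x| ≤ (X : ℤ)) : (s.setMem a x).Bounded X := by
  refine ⟨h.1, fun q => ?_⟩
  simp only [State.setMem, Function.update_apply]
  split_ifs
  exacts [hx, h.2 q]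

/-- The machine state `σ` represents the assignment `s` of values to program variables. -/
def Sim (σ s : State) : Prop :=
  σ.mem = s.mem ∧ ∀ r, σ.reg (2 * r) = s.reg r

/-! ### Size of values and correctness of the compiler -/

/-- The factor `2` serves the sums, as `A + B ≤ 2 * A * B` for positive `A` and `B`. Since `X ≥ 2`,
it is absorbed by the summand `1` in the degree of a binary term. -/
theorem Op.abs_eval_le {x y : ℤ} {A B : ℕ} (hA : 1 ≤ A) (hB : 1 ≤ B) (hx : |x| ≤ (A : ℤ))
    (hy : |y| ≤ (B : ℤ)) (o : Op) : |o.eval x y| ≤ ((A * B * 2 : ℕ) : ℤ) := by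
  have hAB : (A : ℤ) + B ≤ A * B * 2 := by
    have : (1 : ℤ) ≤ A := by exact_mod_cast hA
    have : (1 : ℤ) ≤ B := by exact_mod_cast hB
    nlinarith
  have hA' : (A : ℤ) ≤ A * B * 2 := by linarith [Int.natCast_nonneg B]
  push_cast
  cases o with
  | add => exact ((abs_add_le x y).trans (add_le_add hx hy)).trans hAB
  | sub => exact ((abs_sub x y).trans (add_le_add hx hy)).trans hAB
  | mul =>
    simp only [Op.eval, abs_mul]
    nlinarith [mul_le_mul hx hy (abs_nonneg y) (Int.natCast_nonneg A), abs_nonneg x, abs_nonneg y]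
  | div => exact ((Int.abs_ediv_le_abs x y).trans hx).trans hA'

theorem Term.abs_eval_le {X : ℕ} (hX : 2 ≤ X) {s : State} (hs : s.Bounded X) (e : Term) :
    |e.eval s| ≤ ((X ^ e.deg : ℕ) : ℤ) := by
  have mono : ∀ {i j : ℕ}, i ≤ j → X ^ i ≤ X ^ j := fun h => Nat.pow_le_pow_right (by omega) h
  induction e with
  | var r => simpa [deg] using hs.1 r
  | lit k =>
    have : k.natAbs ≤ X ^ (k.natAbs + 1) :=
      (Nat.lt_pow_self (by omega : 1 < X)).le.trans (mono (by omega))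
    rw [eval_lit, Int.abs_eq_natAbs]
    exact_mod_cast this
  | bin o a b iha ihb =>
    refine (Op.abs_eval_le (Nat.one_le_pow _ _ (by omega)) (Nat.one_le_pow _ _ (by omega))
      iha ihb o).trans ?_
    rw [← pow_add, deg, pow_succ]
    exact_mod_cast Nat.mul_le_mul le_rfl hX
  | read a =>
    refine (hs.2 _).trans ?_
    have : X ^ 1 ≤ X ^ (a.deg + 1) := mono (by omega)
    rw [pow_one] at this
    exact_mod_cast this
  | ite a b p q _ _ ihp ihq =>
    rw [eval_ite]
    split_ifs
    · exact ihp.trans (by exact_mod_cast mono (by simp only [deg]; omega))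
    · exact ihq.trans (by exact_mod_cast mono (by simp only [deg]; omega))

theorem Sim.setTemp {σ s : State} (h : Sim σ s) (t : ℕ) (x : ℤ) :
    Sim (σ.setReg (2 * t + 1) x) s := by
  refine ⟨h.1, fun r => ?_⟩
  rw [← h.2 r]
  exact Function.update_of_ne (by omega) _ _

theorem State.setReg_self (σ : State) (r : ℕ) (x : ℤ) : (σ.setReg r x).reg r = x :=
  Function.update_self _ _ _

theorem State.setReg_of_ne (σ : State) {r q : ℕ} (h : q ≠ r) (x : ℤ) :
    (σ.setReg r x).reg q = σ.reg q :=
  Function.update_of_ne h _ _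

theorem Sim.setVar {σ s : State} (h : Sim σ s) (r : ℕ) (x : ℤ) :
    Sim (σ.setReg (2 * r) x) (s.setReg r x) := by
  refine ⟨h.1, fun q => ?_⟩
  by_cases hq : q = r
  · subst hq; rw [State.setReg_self, State.setReg_self]
  · rw [State.setReg_of_ne _ (by omega), State.setReg_of_ne _ hq, h.2]

/-- The clause on the odd registers below `2 * t + 1` carries the induction: the first operand, left
in the register `2 * t + 1`, survives the evaluation of the second one with working space from `t +
1` on. -/
theorem Term.exec_comp {W X : ℕ} (box : Behaviour) (hX : 2 ≤ X) {s : State} (hs : s.Bounded X)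
    (e : Term) (hW : X ^ e.deg ≤ W) {σ : State} (t : ℕ) (h : Sim σ s) :
    ∃ u σ', Exec W box (e.comp t) σ u σ' ∧ u ≤ e.cost ∧ Sim σ' s ∧
      (∀ j < t, σ'.reg (2 * j + 1) = σ.reg (2 * j + 1)) ∧ σ'.reg (2 * t + 1) = e.eval s := by
  have mono : ∀ {i j : ℕ}, i ≤ j → X ^ j ≤ W → X ^ i ≤ W :=
    fun h hj => (Nat.pow_le_pow_right (by omega) h).trans hj
  have bd : |e.eval s| ≤ (W : ℤ) := (abs_eval_le hX hs e).trans (by exact_mod_cast hW)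
  induction e generalizing σ t with
  | var r =>
    have e1 : Op.add.eval ((σ.setReg (2 * t + 1) 0).reg (2 * t + 1))
        ((σ.setReg (2 * t + 1) 0).reg (2 * r)) = s.reg r := by
      rw [State.setReg_self, State.setReg_of_ne _ (by omega), h.2]
      exact zero_add _
    refine ⟨_, _, .seq (.const _ _ _ (by simp)) (.op _ _ _ _ _ (by rw [e1]; exact bd)), le_rfl,
      (h.setTemp _ _).setTemp _ _, fun j hj => ?_, ?_⟩
    · rw [State.setReg_of_ne _ (by omega), State.setReg_of_ne _ (by omega)]
    · rw [State.setReg_self, e1, eval_var]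
  | lit k =>
    refine ⟨_, _, .const _ _ _ bd, le_rfl, h.setTemp _ _, fun j hj => ?_, ?_⟩
    · rw [State.setReg_of_ne _ (by omega)]
    · rw [State.setReg_self, eval_lit]
  | bin o a b iha ihb =>
    have wa : X ^ a.deg ≤ W := mono (by simp only [deg]; omega) hW
    have wb : X ^ b.deg ≤ W := mono (by simp only [deg]; omega) hW
    obtain ⟨u, σ₁, h₁, hu, m₁, f₁, v₁⟩ :=
      iha wa t h ((abs_eval_le hX hs a).trans (by exact_mod_cast wa))
    obtain ⟨v, σ₂, h₂, hv, m₂, f₂, v₂⟩ :=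
      ihb wb (t + 1) m₁ ((abs_eval_le hX hs b).trans (by exact_mod_cast wb))
    have e1 : o.eval (σ₂.reg (2 * t + 1)) (σ₂.reg (2 * (t + 1) + 1)) = (bin o a b).eval s := by
      rw [f₂ t (by omega), v₁, v₂]; rfl
    refine ⟨_, _, .seq h₁ (.seq h₂ (.op _ _ _ _ _ (by rw [e1]; exact bd))),
      by simp only [cost]; omega, m₂.setTemp _ _, fun j hj => ?_, ?_⟩
    · rw [State.setReg_of_ne _ (by omega), f₂ j (by omega), f₁ j hj]
    · rw [State.setReg_self, e1]
  | read a ih =>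
    have wa : X ^ a.deg ≤ W := mono (by simp only [deg]; omega) hW
    obtain ⟨u, σ₁, h₁, hu, m₁, f₁, v₁⟩ :=
      ih wa t h ((abs_eval_le hX hs a).trans (by exact_mod_cast wa))
    have e1 : σ₁.mem (σ₁.reg (2 * t + 1)) = (read a).eval s := by rw [v₁, m₁.1]; rfl
    refine ⟨_, _, .seq h₁ (.load _ _ _ (by rw [e1]; exact bd)), by simp only [cost]; omega,
      m₁.setTemp _ _, fun j hj => ?_, ?_⟩
    · rw [State.setReg_of_ne _ (by omega), f₁ j hj]
    · rw [State.setReg_self, e1]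
  | ite a b p q iha ihb ihp ihq =>
    have wa : X ^ a.deg ≤ W := mono (by simp only [deg]; omega) hW
    have wb : X ^ b.deg ≤ W := mono (by simp only [deg]; omega) hW
    have wp : X ^ p.deg ≤ W := mono (by simp only [deg]; omega) hW
    have wq : X ^ q.deg ≤ W := mono (by simp only [deg]; omega) hW
    obtain ⟨u, σ₁, h₁, hu, m₁, f₁, v₁⟩ :=
      iha wa t h ((abs_eval_le hX hs a).trans (by exact_mod_cast wa))
    obtain ⟨v, σ₂, h₂, hv, m₂, f₂, v₂⟩ :=
      ihb wb (t + 1) m₁ ((abs_eval_le hX hs b).trans (by exact_mod_cast wb))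
    rw [← f₂ t (by omega)] at v₁
    rw [eval_ite, ← v₁, ← v₂]
    by_cases hc : σ₂.reg (2 * t + 1) < σ₂.reg (2 * (t + 1) + 1)
    · obtain ⟨w, σ₃, h₃, hw, m₃, f₃, v₃⟩ :=
        ihp wp t m₂ ((abs_eval_le hX hs p).trans (by exact_mod_cast wp))
      refine ⟨_, _, .seq h₁ (.seq h₂ (.ifLt_true hc h₃)), by simp only [cost]; omega, m₃,
        fun j hj => ?_, by rw [if_pos hc, v₃]⟩
      rw [f₃ j hj, f₂ j (by omega), f₁ j hj]
    · obtain ⟨w, σ₃, h₃, hw, m₃, f₃, v₃⟩ :=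
        ihq wq t m₂ ((abs_eval_le hX hs q).trans (by exact_mod_cast wq))
      refine ⟨_, _, .seq h₁ (.seq h₂ (.ifLt_false hc h₃)), by simp only [cost]; omega, m₃,
        fun j hj => ?_, by rw [if_neg hc, v₃]⟩
      rw [f₃ j hj, f₂ j (by omega), f₁ j hj]

/-! ### Structured programs -/

namespace Cmd

/-- `r := e` -/
def assign (r : ℕ) (e : Term) : Cmd :=
  .seq (e.comp 0) (.seq (.const (2 * r) 0) (.op .add (2 * r) (2 * r) 1))

/-- `mem[a] := b` -/
def put (a b : Term) : Cmd :=
  .seq (a.comp 0) (.seq (b.comp 1) (.store 1 3))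

/-- `if a < b then p else skip` -/
def when (a b : Term) (p : Cmd) : Cmd :=
  .seq (a.comp 0) (.seq (b.comp 1) (.ifLt 1 3 p .skip))

/-- `r :=` the answer of the black box on the graph with `m` vertices at address `a` -/
def ask (r : ℕ) (m a : Term) : Cmd :=
  .seq (m.comp 0) (.seq (a.comp 1) (.call (2 * r) 1 3))

/-- `i := i + 1` -/
def incr (i : ℕ) : Cmd := assign i (.var i + .lit 1)

/-- evaluation of the loop test `i < b` -/
def test (i : ℕ) (b : Term) : Cmd := .seq ((Term.var i).comp 0) (b.comp 1)

/-- `for i = 0, 1, …, b - 1 do p` -/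
def forLoop (i : ℕ) (b : Term) (p : Cmd) : Cmd :=
  .seq (assign i (.lit 0)) (.seq (test i b) (.whileLt 1 3 (.seq p (.seq (incr i) (test i b)))))

end Cmd

/-- Started with the values `s`, bounded by `X`, of the variables and of the memory, the program `p`
halts after some time `t` with values `s'`, bounded by `X`, such that `Q t s'`. -/
def Runs (W X : ℕ) (box : Behaviour) (p : Cmd) (s : State) (Q : ℕ → State → Prop) : Prop :=
  s.Bounded X → ∀ σ, Sim σ s →
    ∃ t σ' s', Exec W box p σ t σ' ∧ Sim σ' s' ∧ s'.Bounded X ∧ Q t s'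

section Rules

variable {W X : ℕ} {box : Behaviour} {s : State} {Q : ℕ → State → Prop}

theorem Runs.mono {p : Cmd} {Q' : ℕ → State → Prop} (h : Runs W X box p s Q)
    (hQ : ∀ t s', s'.Bounded X → Q t s' → Q' t s') : Runs W X box p s Q' := by
  intro hs σ hσ
  obtain ⟨t, σ', s', h1, h2, h3, h4⟩ := h hs σ hσ
  exact ⟨t, σ', s', h1, h2, h3, hQ t s' h3 h4⟩

theorem Runs.seq {p q : Cmd} {R : ℕ → State → Prop} (hp : Runs W X box p s R)
    (hq : ∀ t s', R t s' → Runs W X box q s' fun t' => Q (t + t')) :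
    Runs W X box (.seq p q) s Q := by
  intro hs σ hσ
  obtain ⟨t, σ', s', h1, h2, h3, h4⟩ := hp hs σ hσ
  obtain ⟨t', σ'', s'', k1, k2, k3, k4⟩ := hq t s' h4 h3 σ' h2
  exact ⟨_, σ'', s'', .seq h1 k1, k2, k3, k4⟩

theorem Runs.assign (hX : 2 ≤ X) (r : ℕ) (e : Term) (hW : X ^ e.deg ≤ W)
    (he : |e.eval s| ≤ (X : ℤ)) (hQ : ∀ t ≤ e.cost + 2, Q t (s.setReg r (e.eval s))) :
    Runs W X box (.assign r e) s Q := by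
  intro hs σ hσ
  obtain ⟨u, σ₁, h₁, hu, m₁, f₁, v₁⟩ := e.exec_comp box hX hs hW 0 hσ
  have e1 : Op.add.eval ((σ₁.setReg (2 * r) 0).reg (2 * r))
      ((σ₁.setReg (2 * r) 0).reg 1) = e.eval s := by
    rw [State.setReg_self, State.setReg_of_ne _ (by omega), ← v₁]
    exact zero_add _
  have bd : |e.eval s| ≤ (W : ℤ) := (e.abs_eval_le hX hs).trans (by exact_mod_cast hW)
  refine ⟨_, _, _, .seq h₁ (.seq (.const _ _ _ (by simp)) (.op _ _ _ _ _ (by rw [e1]; exact bd))),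
    ?_, hs.setReg r he, hQ _ (by omega)⟩
  rw [e1]
  refine ⟨m₁.1, fun q => ?_⟩
  by_cases hq : q = r
  · subst hq; rw [State.setReg_self, State.setReg_self]
  · rw [State.setReg_of_ne _ (by omega), State.setReg_of_ne _ (by omega),
      State.setReg_of_ne _ hq, m₁.2]

/-- Evaluation of two terms into the registers `1` and `3`. -/
theorem Term.exec_comp_two (hX : 2 ≤ X) (hs : s.Bounded X) (a b : Term) (ha : X ^ a.deg ≤ W)
    (hb : X ^ b.deg ≤ W) {σ : State} (hσ : Sim σ s) :
    ∃ u v σ₁ σ', Exec W box (a.comp 0) σ u σ₁ ∧ Exec W box (b.comp 1) σ₁ v σ' ∧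
      u + v ≤ a.cost + b.cost ∧ Sim σ' s ∧ σ'.reg 1 = a.eval s ∧ σ'.reg 3 = b.eval s := by
  obtain ⟨u, σ₁, h₁, hu, m₁, f₁, v₁⟩ := a.exec_comp box hX hs ha 0 hσ
  obtain ⟨v, σ₂, h₂, hv, m₂, f₂, v₂⟩ := b.exec_comp box hX hs hb 1 m₁
  exact ⟨u, v, σ₁, σ₂, h₁, h₂, by omega, m₂, (f₂ 0 (by omega)).trans v₁, v₂⟩

theorem Runs.put (hX : 2 ≤ X) (a b : Term) (ha : X ^ a.deg ≤ W) (hb : X ^ b.deg ≤ W)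
    (he : |b.eval s| ≤ (X : ℤ))
    (hQ : ∀ t ≤ a.cost + b.cost + 1, Q t (s.setMem (a.eval s) (b.eval s))) :
    Runs W X box (.put a b) s Q := by
  intro hs σ hσ
  obtain ⟨u, v, σ₁, σ₂, h₁, h₂, huv, m₂, v₁, v₂⟩ := Term.exec_comp_two hX hs a b ha hb hσ
  refine ⟨_, _, _, .seq h₁ (.seq h₂ (.store _ _ _)), ?_, hs.setMem (a.eval s) he,
    hQ _ (by omega)⟩
  rw [v₁, v₂]
  refine ⟨?_, m₂.2⟩
  simp only [State.setMem, m₂.1]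

/-- Costs of terms are only upper bounds, since the branches of `ite` differ. Hence the
postcondition is required for every overhead `d` up to the bound. -/
theorem Runs.when (hX : 2 ≤ X) (a b : Term) (ha : X ^ a.deg ≤ W) (hb : X ^ b.deg ≤ W) {p : Cmd}
    (hp : a.eval s < b.eval s →
      Runs W X box p s fun t s' => ∀ d ≤ a.cost + b.cost + 1, Q (t + d) s')
    (hn : ¬ a.eval s < b.eval s → ∀ t ≤ a.cost + b.cost + 2, Q t s) :
    Runs W X box (.when a b p) s Q := by
  intro hs σ hσ
  obtain ⟨u, v, σ₁, σ₂, h₁, h₂, huv, m₂, v₁, v₂⟩ := Term.exec_comp_two hX hs a b ha hb hσ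
  by_cases hc : a.eval s < b.eval s
  · obtain ⟨t, σ', s', k1, k2, k3, k4⟩ := hp hc hs σ₂ m₂
    refine ⟨_, _, _, .seq h₁ (.seq h₂ (.ifLt_true (by rwa [v₁, v₂]) k1)), k2, k3, ?_⟩
    have := k4 (u + v + 1) (by omega)
    rwa [show t + (u + v + 1) = u + (v + (t + 1)) by ring] at this
  · exact ⟨_, _, _, .seq h₁ (.seq h₂ (.ifLt_false (by rwa [v₁, v₂]) (.skip _))), m₂, hs,
      hn hc _ (by omega)⟩

theorem Runs.ask (hX : 2 ≤ X) (hXW : X ≤ W) (r : ℕ) (m a : Term) (hm : X ^ m.deg ≤ W)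
    (ha : X ^ a.deg ≤ W) (G : WGraph) {t : ℕ} {z : ℤ} (hn : m.eval s = (G.n : ℤ))
    (hG : Stores s.mem (a.eval s) G) (hbox : box G t z) (hz : |z| ≤ (X : ℤ))
    (hQ : ∀ d ≤ m.cost + a.cost + 2 * G.n ^ 2 + 2, Q (t + d) (s.setReg r z)) :
    Runs W X box (.ask r m a) s Q := by
  intro hs σ hσ
  obtain ⟨u, v, σ₁, σ₂, h₁, h₂, huv, m₂, v₁, v₂⟩ := Term.exec_comp_two hX hs m a hm ha hσ
  refine ⟨_, _, _, .seq h₁ (.seq h₂ (.call _ _ _ _ G t z (by rw [v₁, hn])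
    (by rw [v₂, m₂.1]; exact hG) hbox (hz.trans (by exact_mod_cast hXW)))), m₂.setVar r z,
    hs.setReg r hz, ?_⟩
  have := hQ (u + v + 2 * G.n ^ 2 + 2) (by omega)
  rwa [show t + (u + v + 2 * G.n ^ 2 + 2) = u + (v + (t + 2 * G.n ^ 2 + 2)) by ring] at this

/-- The rule for loops: `Inv k t s` is to hold when the loop is about to be entered for the `k`-th
time, after `t` steps. -/
theorem Runs.forLoop (hX : 2 ≤ X) (hW : X ^ 4 ≤ W) (i : ℕ) (b : Term) (hb : X ^ b.deg ≤ W)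
    {p : Cmd} (L : ℕ) (hL : L ≤ X) (Inv : ℕ → ℕ → State → Prop)
    (hInv : ∀ k t s, Inv k t s → s.reg i = (k : ℤ) ∧ b.eval s = (L : ℤ))
    (h0 : ∀ t ≤ b.cost + 10, Inv 0 t (s.setReg i 0))
    (hstep : ∀ k t s, k < L → s.Bounded X → Inv k t s → Runs W X box p s fun t' s' =>
      s'.reg i = (k : ℤ) ∧
        ∀ d ≤ b.cost + 10, Inv (k + 1) (t + t' + d) (s'.setReg i ((k + 1 : ℕ) : ℤ)))
    (hQ : ∀ t s', s'.Bounded X → Inv L t s' → ∀ d ≤ 1, Q (t + d) s') :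
    Runs W X box (.forLoop i b p) s Q := by
  -- The fourth power in `hW` is for the increment: the term `i + 1` has degree `4`.
  have h2W : X ^ 2 ≤ W := (Nat.pow_le_pow_right (by omega) (by omega)).trans hW
  have h1W : X ^ 1 ≤ W := (Nat.pow_le_pow_right (by omega) (by omega)).trans hW
  have test : ∀ {s : State}, s.Bounded X → ∀ {σ : State}, Sim σ s → ∃ u σ',
      Exec W box (Cmd.test i b) σ u σ' ∧ u ≤ b.cost + 2 ∧ Sim σ' s ∧
      σ'.reg 1 = s.reg i ∧ σ'.reg 3 = b.eval s := by
    intro s hs σ hσ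
    obtain ⟨u, v, σ₁, σ₂, h₁, h₂, huv, m₂, v₁, v₂⟩ :=
      Term.exec_comp_two (box := box) hX hs (.var i) b h1W hb hσ
    exact ⟨_, _, .seq h₁ h₂, by simp only [Term.cost] at huv; omega, m₂, v₁, v₂⟩
  -- Induction on the number `m` of rounds that remain; the registers `1` and `3` already hold both
  -- sides of the loop test.
  have loop : ∀ m k : ℕ, k + m = L → ∀ (t : ℕ) (s σ : State), s.Bounded X → Sim σ s →
      σ.reg 1 = s.reg i → σ.reg 3 = b.eval s → Inv k t s → ∃ t' σ' s',
      Exec W box (.whileLt 1 3 (.seq p (.seq (Cmd.incr i) (Cmd.test i b)))) σ t' σ' ∧ Sim σ' s' ∧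
      s'.Bounded X ∧ Q (t + t') s' := by
    intro m
    induction m with
    | zero =>
      intro k hk t s σ hs hσ e1 e3 hi
      obtain rfl : k = L := by omega
      obtain ⟨i1, i2⟩ := hInv k t s hi
      exact ⟨1, σ, s, .while_false (by rw [e1, e3, i1, i2]; exact lt_irrefl _), hσ, hs,
        hQ t s hs hi 1 le_rfl⟩
    | succ m ih =>
      intro k hk t s σ hs hσ e1 e3 hi
      obtain ⟨i1, i2⟩ := hInv k t s hi
      have hlt : σ.reg 1 < σ.reg 3 := by rw [e1, e3, i1, i2]; exact_mod_cast (by omega : k < L)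
      obtain ⟨t₁, σ₁, s₁, x₁, m₁, b₁, r₁, j₁⟩ := hstep k t s (by omega) hs hi hs σ hσ
      have ev : (Term.var i + Term.lit 1).eval s₁ = ((k + 1 : ℕ) : ℤ) := by
        simp [r₁]
      have hbd : |((k + 1 : ℕ) : ℤ)| ≤ (X : ℤ) := by
        rw [Nat.abs_cast]; exact_mod_cast (by omega : k + 1 ≤ X)
      obtain ⟨t₂, σ₂, s₂, x₂, m₂, b₂, h₂, rfl⟩ :=
        Runs.assign (box := box) (Q := fun t s' => t ≤ 6 ∧ s' = s₁.setReg i ((k + 1 : ℕ) : ℤ))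
          hX i (.var i + .lit 1) hW (by rw [ev]; exact hbd)
          (by rw [ev]; exact fun t ht => ⟨ht, rfl⟩) b₁ σ₁ m₁
      obtain ⟨t₃, σ₃, x₃, h₃, m₃, e1', e3'⟩ := test b₂ m₂
      -- At most `6` steps for the increment, `b.cost + 2` for evaluating the test, and one for the
      -- branch.
      have hd : t₂ + t₃ + 1 ≤ b.cost + 10 := by omega
      obtain ⟨t₄, σ₄, s₄, x₄, m₄, b₄, q₄⟩ :=
        ih (k + 1) (by omega) _ _ σ₃ b₂ m₃ e1' e3' (j₁ _ hd)
      refine ⟨_, σ₄, s₄, .while_true hlt (.seq x₁ (.seq x₂ x₃)) x₄, m₄, b₄, ?_⟩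
      rwa [show t + (t₁ + (t₂ + t₃) + t₄ + 1) = t + t₁ + (t₂ + t₃ + 1) + t₄ by ring]
  intro hs σ hσ
  obtain ⟨t₁, σ₁, s₁, x₁, m₁, b₁, h₁, rfl⟩ :=
    Runs.assign (box := box) (Q := fun t s' => t ≤ 3 ∧ s' = s.setReg i 0)
      hX i (.lit 0) h1W (by simp) (fun t ht => ⟨ht, rfl⟩) hs σ hσ
  obtain ⟨t₂, σ₂, x₂, h₂, m₂, e1, e3⟩ := test b₁ m₁
  obtain ⟨t₃, σ₃, s₃, x₃, m₃, b₃, q₃⟩ :=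
    loop L 0 (by omega) (t₁ + t₂) _ σ₂ b₁ m₂ e1 e3 (h0 _ (by omega))
  exact ⟨_, σ₃, s₃, .seq x₁ (.seq x₂ x₃), m₃, b₃, by rwa [← add_assoc]⟩

end Rules


/-! ### Negative triangles in blocks of vertices -/

/-- `u → a → b → u` is a triangle of negative weight. -/
def WGraph.NegTri (G : WGraph) (u a b : ℕ) : Prop :=
  G.entry u a + G.entry a b + G.entry b u < 0

theorem WGraph.entry_ne_top {G : WGraph} {u v : ℕ} (h : G.entry u v ≠ ⊤) :
    u < G.n ∧ v < G.n ∧ u ≠ v := by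
  unfold WGraph.entry at h
  split_ifs at h with hc
  · refine ⟨hc.1, hc.2, ?_⟩
    rintro rfl
    exact h (G.loopless _)
  · exact absurd rfl h

theorem ne_top_of_add_lt_zero {x y z : WithTop ℤ} (h : x + y + z < 0) :
    x ≠ ⊤ ∧ y ≠ ⊤ ∧ z ≠ ⊤ := by
  refine ⟨?_, ?_, ?_⟩ <;> rintro rfl <;> simp at h

theorem WGraph.NegTri.lt {G : WGraph} {u a b : ℕ} (h : G.NegTri u a b) :
    u < G.n ∧ a < G.n ∧ b < G.n := by
  obtain ⟨h1, h2, h3⟩ := ne_top_of_add_lt_zero h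
  exact ⟨(entry_ne_top h1).1, (entry_ne_top h2).1, (entry_ne_top h3).1⟩

/-- A negative sum has three finite terms, while the diagonal is `⊤`; so the corners are
automatically distinct. -/
theorem WGraph.inNegativeTriangle_iff_exists (G : WGraph) (v : Fin G.n) :
    G.InNegativeTriangle v ↔ ∃ a b, G.w v a + G.w a b + G.w b v < 0 := by
  refine ⟨fun ⟨a, b, _, _, _, h⟩ => ⟨a, b, h⟩, fun ⟨a, b, h⟩ => ?_⟩
  obtain ⟨h1, h2, h3⟩ := ne_top_of_add_lt_zero h
  refine ⟨a, b, ?_, ?_, ?_, h⟩ <;> rintro rfl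
  exacts [h1 (G.loopless _), h2 (G.loopless _), h3 (G.loopless _)]

theorem WGraph.inNegativeTriangle_iff (G : WGraph) (v : Fin G.n) :
    G.InNegativeTriangle v ↔ ∃ a b, G.NegTri v a b := by
  have key : ∀ i j : Fin G.n, G.entry i j = G.w i j := by simp [WGraph.entry]
  rw [inNegativeTriangle_iff_exists]
  constructor
  · rintro ⟨a, b, h⟩
    exact ⟨a, b, by simpa only [NegTri, key] using h⟩
  · rintro ⟨a, b, h⟩
    obtain ⟨_, ha, hb⟩ := h.lt
    refine ⟨⟨a, ha⟩, ⟨b, hb⟩, ?_⟩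
    rw [← key, ← key, ← key]
    exact h

/-- The `p`-th digit of `t` in base `S`. -/
def dig (S : ℕ) : ℕ → ℕ → ℕ
  | 0, t => t % S
  | p + 1, t => dig S p (t / S)

theorem dig_lt {S : ℕ} (hS : 0 < S) (p t : ℕ) : dig S p t < S := by
  induction p generalizing t with
  | zero => exact Nat.mod_lt _ hS
  | succ p ih => exact ih _

/-- This lets one loop counter below `S ^ 3` run through all triples, both of blocks (`T`) and of
positions inside the blocks (`f`). -/
theorem exists_dig {S i j k : ℕ} (hi : i < S) (hj : j < S) (hk : k < S) :
    ∃ t < S * (S * S), dig S 0 t = i ∧ dig S 1 t = j ∧ dig S 2 t = k := by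
  have hS : 0 < S := by omega
  have lt : ∀ {x y M : ℕ}, x < S → y < M → x + S * y < S * M := fun {x y M} hx hy => by
    have := Nat.mul_le_mul_left S (show y + 1 ≤ M from hy)
    rw [Nat.mul_add] at this
    omega
  have dm : ∀ {x : ℕ} (y : ℕ), x < S → (x + S * y) % S = x ∧ (x + S * y) / S = y :=
    fun {x} y hx => ⟨by rw [Nat.add_mul_mod_self_left, Nat.mod_eq_of_lt hx],
      by rw [Nat.add_mul_div_left _ _ hS, Nat.div_eq_of_lt hx, zero_add]⟩
  refine ⟨i + S * (j + S * k), lt hi (lt hj hk), ?_, ?_, ?_⟩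
  · exact (dm _ hi).1
  · simp only [dig, (dm _ hi).2, (dm _ hj).1]
  · simp only [dig, (dm _ hi).2, (dm _ hj).2, Nat.mod_eq_of_lt hk]

/-- The vertex number `i` of the block of size `S` whose number is the `p`-th digit of `T`. -/
def vert (S T p i : ℕ) : ℕ := dig S p T * S + i

/-- The digits of `f` pick a negative triangle in the three blocks given by the digits of `T`. -/
def WGraph.BlockTri (G : WGraph) (S T f : ℕ) : Prop :=
  G.NegTri (vert S T 0 (dig S 0 f)) (vert S T 1 (dig S 1 f)) (vert S T 2 (dig S 2 f))

/-- Divide the three corners by `S`: the quotients, less than `S` because `n ≤ S * S`, are the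
digits of `T`, and the remainders are those of `f`. -/
theorem WGraph.NegTri.exists_blockTri {G : WGraph} {S u a b : ℕ} (hS : G.n ≤ S * S)
    (h : G.NegTri u a b) :
    ∃ T < S * (S * S), ∃ f < S * (S * S), u = vert S T 0 (dig S 0 f) ∧ G.BlockTri S T f := by
  obtain ⟨hu, ha, hb⟩ := h.lt
  have hS0 : 0 < S := by
    rcases Nat.eq_zero_or_pos S with rfl | h
    · simp at hS; omega
    · exact h
  have q : ∀ {x}, x < G.n → x / S < S := fun hx => Nat.div_lt_of_lt_mul (hx.trans_le hS)
  have r : ∀ x, x % S < S := fun x => Nat.mod_lt x hS0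
  obtain ⟨T, hT, T0, T1, T2⟩ := exists_dig (q hu) (q ha) (q hb)
  obtain ⟨f, hf, f0, f1, f2⟩ := exists_dig (r u) (r a) (r b)
  refine ⟨T, hT, f, hf, ?_, ?_⟩
  · rw [vert, T0, f0, Nat.div_add_mod']
  · simp only [BlockTri, vert, T0, T1, T2, f0, f1, f2, Nat.div_add_mod']
    exact h

/-- The vertex of the input that corresponds to the vertex `x` of the query. -/
def queryVert (S T x : ℕ) : ℕ := vert S T (x / S) (x % S)

/-- The weight of the edge `(x, y)` of the query for the three blocks given by the digits of `T`.
The query has a part for each of the blocks, and edges from each part to the next one only. The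
vertices in `D` are left out of the first part. -/
def queryWeight (G : WGraph) (S T : ℕ) (D : Finset ℕ) (x y : ℕ) : WithTop ℤ :=
  if y / S = (x / S + 1) % 3 ∧ ¬ (x / S = 0 ∧ queryVert S T x ∈ D) then
    G.entry (queryVert S T x) (queryVert S T y) else ⊤

theorem div_lt_three {S x : ℕ} (hx : x < 3 * S) : x / S < 3 :=
  Nat.div_lt_of_lt_mul (by rwa [mul_comm])

def queryGraph (G : WGraph) (S T : ℕ) (D : Finset ℕ) : WGraph where
  n := 3 * S
  w x y := queryWeight G S T D x y
  loopless x := if_neg fun h => by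
    have := div_lt_three x.2
    omega

theorem WGraph.WeightsBounded.entry {G : WGraph} {M : ℕ} (hG : G.WeightsBounded M) {i j : ℕ} {x : ℤ}
    (h : G.entry i j = (x : WithTop ℤ)) : |x| ≤ (M : ℤ) := by
  unfold WGraph.entry at h
  split_ifs at h with hc
  · exact hG _ _ _ h
  · exact absurd h.symm (WithTop.coe_ne_top)

/-! ### What a query detects -/

section Query

variable {G : WGraph} {S T : ℕ} {D : Finset ℕ}

theorem queryGraph_weightsBounded {M : ℕ} (hG : G.WeightsBounded M) :
    (queryGraph G S T D).WeightsBounded M := by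
  intro i j x h
  simp only [queryGraph, queryWeight] at h
  split_ifs at h
  · exact hG.entry h
  · exact absurd h.symm (WithTop.coe_ne_top)

/-- Finite weights force `y` into part `1` and `z` into part `2`. The edge leaving `x` shows that
`x` is not in `D`, so it is enough that marked vertices lose their outgoing edges. -/
theorem exists_blockTri_of_queryWeight {x y z : ℕ} (hS : 0 < S) (hx : x / S = 0)
    (h : queryWeight G S T D x y + queryWeight G S T D y z + queryWeight G S T D z x < 0) :
    ∃ f < S * (S * S), vert S T 0 (dig S 0 f) ∉ D ∧ G.BlockTri S T f := by
  obtain ⟨h1, h2, h3⟩ := ne_top_of_add_lt_zero h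
  simp only [queryWeight] at h h1 h2 h3
  have c1 := (ite_ne_right_iff.mp h1).1
  have c2 := (ite_ne_right_iff.mp h2).1
  have c3 := (ite_ne_right_iff.mp h3).1
  rw [if_pos c1, if_pos c2, if_pos c3] at h
  obtain ⟨f, hf, f0, f1, f2⟩ := exists_dig (Nat.mod_lt x hS) (Nat.mod_lt y hS) (Nat.mod_lt z hS)
  have hy : y / S = 1 := by omega
  have hz : z / S = 2 := by omega
  have c1' := c1.2
  simp only [queryVert, hx, hy, hz, true_and] at h c1'
  refine ⟨f, hf, by rwa [f0], ?_⟩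
  rwa [WGraph.BlockTri, f0, f1, f2]

theorem queryGraph_exists_iff :
    (∃ v, (queryGraph G S T D).InNegativeTriangle v) ↔
      ∃ f < S * (S * S), vert S T 0 (dig S 0 f) ∉ D ∧ G.BlockTri S T f := by
  simp only [WGraph.inNegativeTriangle_iff_exists, queryGraph]
  constructor
  · rintro ⟨x, y, z, h⟩
    have hS : 0 < S := by have := x.2; omega
    have hx := div_lt_three x.2
    obtain ⟨h1, h2, h3⟩ := ne_top_of_add_lt_zero h
    simp only [queryWeight] at h1 h2 h3
    have c1 := (ite_ne_right_iff.mp h1).1.1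
    have c2 := (ite_ne_right_iff.mp h2).1.1
    -- The three parts are consecutive modulo `3`, so one of them is part `0`; the triangle is then
    -- rotated to start there.
    have hc : (x : ℕ) / S = 0 ∨ (y : ℕ) / S = 0 ∨ (z : ℕ) / S = 0 := by
      generalize (x : ℕ) / S = p at *
      generalize (y : ℕ) / S = q at *
      omega
    rcases hc with hc | hc | hc
    · exact exists_blockTri_of_queryWeight hS hc h
    · exact exists_blockTri_of_queryWeight (x := y) (y := z) (z := x) hS hc
        (by rwa [add_assoc, add_comm] at h)
    · exact exists_blockTri_of_queryWeight (x := z) (y := x) (z := y) hS hc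
        (by rwa [add_comm, ← add_assoc] at h)
  · rintro ⟨f, hf, hD, h⟩
    have hS : 0 < S := Nat.pos_of_ne_zero fun h0 => by simp [h0] at hf
    have d := fun p => dig_lt hS p f
    have dm : ∀ p, p < 3 → ∃ x : Fin (3 * S), (x : ℕ) / S = p ∧ (x : ℕ) % S = dig S p f := by
      intro p hp
      have hlt : S * p + dig S p f < 3 * S := by
        have := Nat.mul_le_mul_left S (show p ≤ 2 by omega)
        have := d p
        omega
      exact ⟨⟨S * p + dig S p f, hlt⟩, by
        simp only [Nat.mul_add_div hS, Nat.div_eq_of_lt (d p), add_zero],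
        by simp only [Nat.mul_add_mod, Nat.mod_eq_of_lt (d p)]⟩
    obtain ⟨x, x1, x2⟩ := dm 0 (by omega)
    obtain ⟨y, y1, y2⟩ := dm 1 (by omega)
    obtain ⟨z, z1, z2⟩ := dm 2 (by omega)
    refine ⟨x, y, z, ?_⟩
    simp only [queryWeight, queryVert, x1, x2, y1, y2, z1, z2]
    simpa [hD, WGraph.BlockTri, WGraph.NegTri] using h

end Query

/-! ### The program -/

/-- The two words that encode an entry of the weight matrix. -/
def word (b : ℕ) (e : WithTop ℤ) : ℤ := if b = 0 then edgeFlag e else edgeWeight e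

theorem word_top (b : ℕ) : word b ⊤ = 0 := by
  simp [word, edgeFlag, edgeWeight]

namespace Term

/-- The `p`-th digit of `a` in base `S`. The variable `1` holds `S`. -/
def digit : ℕ → Term → Term
  | 0, a => a % var 1
  | p + 1, a => digit p (a / var 1)

/-- The `i`-th vertex of the `p`-th block. The variable `2` holds `T`. -/
def vertex (p : ℕ) (i : Term) : Term := digit p (var 2) * var 1 + i

/-- The word `b` of the entry at `(u, v)` of the weight matrix. -/
def entry (b : ℕ) (u v : Term) : Term :=
  ite u (var 0) (ite v (var 0) (read (lit 2 * (u * var 0 + v) + lit b)) (lit 0)) (lit 0)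

/-- Whether the vertex `u` is marked. -/
def mark (u : Term) : Term := read (lit (-1) - u)

def queryVertex (x : Term) : Term :=
  ite (x / var 1) (lit 1) (vertex 0 (x % var 1))
    (ite (x / var 1) (lit 2) (vertex 1 (x % var 1)) (vertex 2 (x % var 1)))

/-- The word `b` of the entry at `(x, y)` of the weight matrix of the query. -/
def queryEntry (b : ℕ) (x y : Term) : Term :=
  ite ((y / var 1 - x / var 1 - lit 1) % lit 3) (lit 1)
    (ite (mark (queryVertex x)) (x / var 1 + lit 1) (entry b (queryVertex x) (queryVertex y)) (lit 0))
    (lit 0)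

def querySize : Term := lit 3 * var 1

/-- The first address after the `2 * n ^ 2` words of the input. -/
def queryAddress : Term := lit 2 * (var 0 * var 0)

/-- The product of the three flags with the sum of the three weights. -/
def triangle (u a b : Term) : Term :=
  entry 0 u a * (entry 0 a b * entry 0 b u) * (entry 1 u a + entry 1 a b + entry 1 b u)

/-- The variable `3` holds `f`, whose digits are the positions inside the three blocks. -/
def corner (p : ℕ) : Term := vertex p (digit p (var 3))

/-- The new mark of the first corner of a triple. -/
def newMark : Term :=
  ite (triangle (corner 0) (corner 1) (corner 2)) (lit 0) (lit 1) (mark (corner 0))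

def cube : Term := var 1 * (var 1 * var 1)

end Term

open Term in
/-- `S := min {S | n ≤ S * S}` -/
def findSide : Cmd :=
  .forLoop 3 (var 0) (.assign 1 (ite (var 1 * var 1) (var 0) (var 1 + lit 1) (var 1)))

open Term in
/-- Store the word `b` of the entry number `e` of the weight matrix of the query, where the variable
`3` holds `e`. -/
def storeWord (b : ℕ) : Cmd :=
  .put (queryAddress + lit 2 * var 3 + lit b)
    (queryEntry b (var 3 / querySize) (var 3 % querySize))

open Term in
def buildQuery : Cmd :=
  .forLoop 3 (querySize * querySize) (.seq (storeWord 0) (storeWord 1))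

open Term in
/-- Mark the vertices of the first block that are in negative triangles with the other two blocks. -/
def markBlock : Cmd :=
  .forLoop 3 cube (.put (lit (-1) - corner 0) newMark)

open Term in
def processBlock : Cmd :=
  .seq buildQuery (.seq (.ask 4 querySize queryAddress) (.when (lit 0) (var 4) markBlock))

open Term in
/-- Return a vertex without a mark, or `-1` if there is none. -/
def findUnmarked : Cmd :=
  .seq (.assign 4 (lit (-1)))
    (.seq (.forLoop 3 (var 0) (.assign 4 (ite (mark (var 3)) (lit 1) (var 3) (var 4))))
      (.assign 0 (var 4)))

def reduction : Cmd :=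
  .seq findSide (.seq (.forLoop 2 Term.cube processBlock) findUnmarked)

/-! ### Values of the terms of the program -/

/-- The variables `0` and `1` and the input in the memory have the intended values. -/
structure Frame (G : WGraph) (S : ℕ) (s : State) : Prop where
  size : s.reg 0 = (G.n : ℤ)
  side : s.reg 1 = (S : ℤ)
  input : ∀ b : ℕ, b < 2 → ∀ u v : ℕ, u < G.n → v < G.n →
    s.mem (2 * ((u : ℤ) * G.n + v) + b) = word b (G.entry u v)

/-- The set of marked vertices is `D`. -/
def Marks (D : Finset ℕ) (s : State) : Prop :=
  ∀ v : ℕ, s.mem (-1 - v) = if v ∈ D then 1 else 0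

section Eval

open Term

variable {G : WGraph} {S : ℕ} {s : State}

theorem Frame.eval_digit (h : Frame G S s) (p : ℕ) {a : Term} {t : ℕ} (ha : a.eval s = (t : ℤ)) :
    (digit p a).eval s = (dig S p t : ℤ) := by
  induction p generalizing a t with
  | zero => simp [digit, dig, ha, h.side]
  | succ p ih =>
    exact ih (by simp [ha, h.side])

theorem Frame.eval_vertex (h : Frame G S s) {T : ℕ} (hT : s.reg 2 = (T : ℤ)) (p : ℕ) {a : Term}
    {i : ℕ} (ha : a.eval s = (i : ℤ)) : (vertex p a).eval s = (vert S T p i : ℤ) := by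
  simp [vertex, vert, ha, h.side, h.eval_digit p (a := var 2) hT]

theorem Frame.eval_entry (h : Frame G S s) {b : ℕ} (hb : b < 2) {x y : Term} {u v : ℕ}
    (hx : x.eval s = (u : ℤ)) (hy : y.eval s = (v : ℤ)) :
    (entry b x y).eval s = word b (G.entry u v) := by
  simp only [entry, eval_ite, eval_read, eval_add, eval_mul, eval_lit, eval_var, hx, hy, h.size,
    Nat.cast_lt]
  by_cases hu : u < G.n
  · by_cases hv : v < G.n
    · rw [if_pos hu, if_pos hv, h.input b hb u v hu hv]
    · rw [if_pos hu, if_neg hv, WGraph.entry, dif_neg (by tauto), word_top]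
  · rw [if_neg hu, WGraph.entry, dif_neg (by tauto), word_top]

theorem Frame.eval_queryVertex (h : Frame G S s) {T : ℕ} (hT : s.reg 2 = (T : ℤ)) {a : Term} {x : ℕ}
    (ha : a.eval s = (x : ℤ)) (hx : x < 3 * S) :
    (queryVertex a).eval s = (queryVert S T x : ℤ) := by
  have hm : (a % var 1).eval s = ((x % S : ℕ) : ℤ) := by simp [ha, h.side]
  have hq : (a / var 1).eval s = ((x / S : ℕ) : ℤ) := by simp [ha, h.side]
  have h3 := div_lt_three hx
  simp only [queryVertex, eval_ite, hq, eval_lit, h.eval_vertex hT _ hm, queryVert]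
  generalize x / S = p at h3
  interval_cases p <;> simp

theorem Frame.eval_queryEntry (h : Frame G S s) {T : ℕ} (hT : s.reg 2 = (T : ℤ)) {D : Finset ℕ} (hD : Marks D s) {b : ℕ} (hb : b < 2) {x' y' : Term}
    {x y : ℕ} (hx : x'.eval s = (x : ℤ)) (hy : y'.eval s = (y : ℤ)) (hx3 : x < 3 * S)
    (hy3 : y < 3 * S) :
    (queryEntry b x' y').eval s = word b (queryWeight G S T D x y) := by
  have q1 := h.eval_queryVertex hT hx hx3
  have q2 := h.eval_queryVertex hT hy hy3
  have x3 := div_lt_three hx3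
  have y3 := div_lt_three hy3
  have hx' : (x' / var 1).eval s = ((x / S : ℕ) : ℤ) := by simp [hx, h.side]
  have hy' : (y' / var 1).eval s = ((y / S : ℕ) : ℤ) := by simp [hy, h.side]
  have hm : (mark (queryVertex x')).eval s = if queryVert S T x ∈ D then 1 else 0 := by
    rw [mark, eval_read, eval_sub, q1, eval_lit, hD]
  simp only [queryEntry, eval_ite, eval_mod, eval_sub, eval_add, hx', hy', eval_lit, hm,
    h.eval_entry hb q1 q2, queryWeight]
  generalize x / S = p at x3
  generalize y / S = q at y3
  -- The machine only compares by `<`. For parts below `3`, the remainder of `q - p - 1` modulo `3`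
  -- is below `1` exactly when `q` is the part after `p`; and the mark is below `p + 1` unless it is
  -- `1` and `p = 0`.
  by_cases c1 : q = (p + 1) % 3
  · rw [if_pos (by omega)]
    by_cases c2 : queryVert S T x ∈ D
    · rw [if_pos c2]
      by_cases c3 : p = 0
      · rw [if_neg (by omega), if_neg (by tauto), word_top]
      · rw [if_pos (by omega), if_pos (by tauto)]
    · rw [if_neg c2, if_pos (by omega), if_pos (by tauto)]
  · rw [if_neg (by omega), if_neg (by tauto), word_top]

/-- A missing edge has flag `0`, which makes the product `0` and so not negative; if all edges
exist, the product is the weight of the triangle. -/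
theorem Frame.eval_triangle (h : Frame G S s) {x y z : Term} {u a b : ℕ} (hx : x.eval s = (u : ℤ))
    (hy : y.eval s = (a : ℤ)) (hz : z.eval s = (b : ℤ)) :
    (triangle x y z).eval s < 0 ↔ G.NegTri u a b := by
  have e : ∀ {b} {x y : Term} {u v : ℕ}, b < 2 → x.eval s = (u : ℤ) → y.eval s = (v : ℤ) →
      (entry b x y).eval s = word b (G.entry u v) :=
    fun hb hx hy => h.eval_entry hb hx hy
  simp only [triangle, eval_mul, eval_add, e Nat.zero_lt_two hx hy, e Nat.zero_lt_two hy hz,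
    e Nat.zero_lt_two hz hx, e Nat.one_lt_two hx hy, e Nat.one_lt_two hy hz,
    e Nat.one_lt_two hz hx, WGraph.NegTri]
  generalize G.entry u a = p
  generalize G.entry a b = q
  generalize G.entry b u = r
  cases p <;> cases q <;> cases r <;> simp [word, edgeFlag, edgeWeight]
  norm_cast

theorem Frame.eval_newMark (h : Frame G S s) {T f : ℕ} (hT : s.reg 2 = (T : ℤ))
    (hf : s.reg 3 = (f : ℤ)) {D : Finset ℕ} (hD : Marks D s)
    [Decidable (G.BlockTri S T f)] :
    (corner 0).eval s = (vert S T 0 (dig S 0 f) : ℤ) ∧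
    newMark.eval s = if G.BlockTri S T f ∨ vert S T 0 (dig S 0 f) ∈ D then 1 else 0 := by
  have c : ∀ p, (corner p).eval s = (vert S T p (dig S p f) : ℤ) :=
    fun p => h.eval_vertex hT p (h.eval_digit p hf)
  refine ⟨c 0, ?_⟩
  have hm : (mark (corner 0)).eval s = if vert S T 0 (dig S 0 f) ∈ D then 1 else 0 := by
    rw [mark, eval_read, eval_sub, c, eval_lit, hD]
  have ht : (triangle (corner 0) (corner 1) (corner 2)).eval s < 0 ↔ G.BlockTri S T f :=
    h.eval_triangle (c 0) (c 1) (c 2)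
  rw [newMark, eval_ite, eval_lit, hm, eval_lit]
  simp only [ht, ite_or]

theorem Frame.eval_querySize (h : Frame G S s) : querySize.eval s = ((3 * S : ℕ) : ℤ) := by
  simp [querySize, h.side]

theorem Frame.eval_queryAddress (h : Frame G S s) :
    queryAddress.eval s = 2 * ((G.n : ℤ) * G.n) := by
  simp [queryAddress, h.size]

theorem Frame.eval_cube (h : Frame G S s) : cube.eval s = ((S * (S * S) : ℕ) : ℤ) := by
  simp [cube, h.side]

end Eval


/-! ### Correctness and running time of the program -/

open Term

section Frames

variable {G : WGraph} {S : ℕ} {s : State} {D : Finset ℕ}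

theorem Frame.setReg (h : Frame G S s) {r : ℕ} (hr : 2 ≤ r) (x : ℤ) : Frame G S (s.setReg r x) :=
  ⟨by rw [State.setReg_of_ne _ (by omega), h.size], by rw [State.setReg_of_ne _ (by omega), h.side],
    h.input⟩

theorem Frame.setMem (h : Frame G S s) {a : ℤ} (ha : a < 0 ∨ 2 * ((G.n : ℤ) * G.n) ≤ a) (x : ℤ) :
    Frame G S (s.setMem a x) := by
  refine ⟨h.size, h.side, fun b hb u v hu hv => ?_⟩
  rw [← h.input b hb u v hu hv]
  refine Function.update_of_ne ?_ _ _
  have h1 : u * G.n + v < G.n * G.n := by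
    calc u * G.n + v < u * G.n + G.n := by omega
      _ = (u + 1) * G.n := by ring
      _ ≤ G.n * G.n := Nat.mul_le_mul_right _ hu
  have h2 : (u : ℤ) * G.n + v < G.n * G.n := by exact_mod_cast h1
  have h3 : (0 : ℤ) ≤ (u : ℤ) * G.n + v := by positivity
  omega

/-- Marks live at the negative addresses, away from the input and the query. -/
theorem Marks.setMem (h : Marks D s) {a : ℤ} (ha : 0 ≤ a) (x : ℤ) : Marks D (s.setMem a x) :=
  fun v => (Function.update_of_ne (by omega) _ _).trans (h v)

theorem abs_word_le {X b : ℕ} (hX : 2 ≤ X) {e : WithTop ℤ}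
    (he : ∀ x : ℤ, e = (x : WithTop ℤ) → |x| ≤ (X : ℤ)) : |word b e| ≤ (X : ℤ) := by
  have hX' : (1 : ℤ) ≤ X := by exact_mod_cast (by omega : 1 ≤ X)
  cases e with
  | top => rw [word_top, abs_zero]; omega
  | coe x =>
    unfold word
    split_ifs
    · simpa [edgeFlag] using hX'
    · simpa [edgeWeight] using he x rfl

end Frames

/-- The vertices of the first block that are found by the first `k` triples. -/
noncomputable def found (G : WGraph) (S T k : ℕ) : Finset ℕ :=
  open Classical in
  ((Finset.range k).filter (G.BlockTri S T)).image fun f => vert S T 0 (dig S 0 f)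

theorem mem_found {G : WGraph} {S T k v : ℕ} :
    v ∈ found G S T k ↔ ∃ f < k, G.BlockTri S T f ∧ vert S T 0 (dig S 0 f) = v := by
  simp [found, and_assoc]

/-- The terms of the program can be evaluated with words in `[-W, W]` when all variables and memory
cells are at most `X` in absolute value. -/
def Fits (X W : ℕ) : Prop := ∀ d ≤ 1000, X ^ d ≤ W

/-! ### Effect and running time of each loop -/

section Loops

variable {W X : ℕ} {box : Behaviour} {G : WGraph} {S : ℕ} {s : State}

theorem runs_findSide (hX : 2 ≤ X) (hW : Fits X W) (hn : G.n + 1 ≤ X) (hs : Frame G 0 s) :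
    Runs W X box findSide s fun t s' => t ≤ 2000 * (G.n + 2) ∧ s'.mem = s.mem ∧
      ∃ S, Frame G S s' ∧ G.n ≤ S * S ∧ S ≤ G.n ∧ (S = 0 ∨ (S - 1) * (S - 1) < G.n) := by
  -- As long as `S * S < n`, each round raises `S`, so `S` equals `k` until it is large enough. The
  -- last clause records the test that allowed the latest increment; it will bound `S` from above.
  refine Runs.forLoop hX (hW _ (by decide)) 3 (var 0) (hW _ (by decide)) G.n (by omega)
    (fun k t s' => t ≤ 2000 * (k + 1) ∧ s'.mem = s.mem ∧ s'.reg 3 = (k : ℤ) ∧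
      ∃ S, Frame G S s' ∧ S ≤ k ∧ (S = k ∨ G.n ≤ S * S) ∧ (S = 0 ∨ (S - 1) * (S - 1) < G.n))
    ?_ ?_ ?_ ?_
  · rintro k t s' ⟨-, -, h3, S, hf, -⟩
    exact ⟨h3, hf.size⟩
  · intro t ht
    simp only [cost] at ht
    exact ⟨by omega, rfl, State.setReg_self _ _ _, 0, hs.setReg (by omega) _, le_rfl, .inl rfl,
      .inl rfl⟩
  · rintro k t s' hk - ⟨ht, hm, h3, S, hf, hSk, hS, hS'⟩
    have ev : (ite (var 1 * var 1) (var 0) (var 1 + lit 1) (var 1)).eval s' =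
        ((if S * S < G.n then S + 1 else S : ℕ) : ℤ) := by
      simp only [eval_ite, eval_mul, eval_add, eval_var, eval_lit, hf.size, hf.side]
      norm_cast
    refine Runs.assign hX _ _ (hW _ (by decide)) ?_ fun t' ht' => ⟨?_, fun d hd => ?_⟩
    · rw [ev, Nat.abs_cast]
      exact_mod_cast (by split_ifs <;> omega :
        (if S * S < G.n then S + 1 else S) ≤ X)
    · rw [State.setReg_of_ne _ (by omega), h3]
    · simp only [cost] at hd
      have : (ite (var 1 * var 1) (var 0) (var 1 + lit 1) (var 1)).cost ≤ 1000 := by decide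
      refine ⟨by omega, hm, State.setReg_self _ _ _, if S * S < G.n then S + 1 else S, ?_, ?_⟩
      · have hf' : Frame G (if S * S < G.n then S + 1 else S) (s'.setReg 1
            ((ite (var 1 * var 1) (var 0) (var 1 + lit 1) (var 1)).eval s')) :=
          ⟨by rw [State.setReg_of_ne _ (by omega), hf.size], by rw [State.setReg_self, ev],
            hf.input⟩
        exact hf'.setReg (by omega) _
      · split_ifs with hc
        · exact ⟨by omega, by omega, .inr (by simpa using hc)⟩
        · exact ⟨by omega, .inr (by omega), hS'⟩
  · rintro t s' - ⟨ht, hm, -, S, hf, hSk, hS, hS'⟩ d hd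
    refine ⟨by omega, hm, S, hf, ?_, hSk, hS'⟩
    rcases hS with rfl | h
    · exact Nat.le_mul_self _
    · exact h

/-- The state during the treatment of the blocks given by the digits of `T`. -/
structure BlockState (G : WGraph) (S T : ℕ) (D : Finset ℕ) (s : State) : Prop
    extends frame : Frame G S s where
  block : s.reg 2 = (T : ℤ)
  marks : Marks D s

theorem BlockState.setReg {T : ℕ} {D : Finset ℕ} (h : BlockState G S T D s) {r : ℕ} (hr : 3 ≤ r)
    (x : ℤ) : BlockState G S T D (s.setReg r x) :=
  ⟨h.frame.setReg (by omega) x, by rw [State.setReg_of_ne _ (by omega), h.block], h.marks⟩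

theorem BlockState.setMem {T : ℕ} {D : Finset ℕ} (h : BlockState G S T D s) {a : ℤ}
    (ha : 2 * ((G.n : ℤ) * G.n) ≤ a) (x : ℤ) : BlockState G S T D (s.setMem a x) :=
  ⟨h.frame.setMem (.inr ha) x, h.block, h.marks.setMem (le_trans (by positivity) ha) x⟩

theorem runs_storeWord (hX : 2 ≤ X) (hW : Fits X W) {M : ℕ} (hM : M ≤ X)
    (hG : G.WeightsBounded M) {T : ℕ} {D : Finset ℕ} (hs : BlockState G S T D s) {b : ℕ}
    (hb : b < 2) {e : ℕ} (he : e < 3 * S * (3 * S)) (h3 : s.reg 3 = (e : ℤ)) :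
    Runs W X box (storeWord b) s fun t s' => t ≤ 1500 ∧
      s' = s.setMem (2 * ((G.n : ℤ) * G.n) + 2 * e + b)
        (word b (queryWeight G S T D (e / (3 * S)) (e % (3 * S)))) := by
  have ea : (queryAddress + lit 2 * var 3 + lit b).eval s =
      2 * ((G.n : ℤ) * G.n) + 2 * e + b := by
    simp [hs.frame.eval_queryAddress, h3]
  have hS : 0 < 3 * S := Nat.pos_of_ne_zero fun h => by simp [h] at he
  have eq : (queryEntry b (var 3 / querySize) (var 3 % querySize)).eval s =
      word b (queryWeight G S T D (e / (3 * S)) (e % (3 * S))) := by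
    refine hs.frame.eval_queryEntry hs.block hs.marks hb ?_ ?_ (Nat.div_lt_of_lt_mul he)
      (Nat.mod_lt _ hS)
    · rw [eval_div, hs.frame.eval_querySize, eval_var, h3, Int.natCast_div]
    · rw [eval_mod, hs.frame.eval_querySize, eval_var, h3, Int.natCast_mod]
  refine Runs.put hX _ _ (hW _ ?_) (hW _ ?_) ?_ fun t ht => ⟨ht.trans ?_, by rw [ea, eq]⟩
  · interval_cases b <;> decide
  · interval_cases b <;> decide
  · rw [eq]
    refine abs_word_le hX fun x hx => ?_
    exact ((queryGraph_weightsBounded hG ⟨_, Nat.div_lt_of_lt_mul he⟩ ⟨_, Nat.mod_lt _ hS⟩ x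
      hx).trans (by exact_mod_cast hM))
  · interval_cases b <;> decide

theorem runs_buildQuery (hX : 2 ≤ X) (hW : Fits X W) {M : ℕ} (hM : M ≤ X)
    (hG : G.WeightsBounded M) (hS : 3 * S * (3 * S) ≤ X) {T : ℕ} {D : Finset ℕ}
    (hs : BlockState G S T D s) :
    Runs W X box buildQuery s fun t s' => t ≤ 4000 * (3 * S * (3 * S) + 1) ∧
      BlockState G S T D s' ∧ Stores s'.mem (2 * ((G.n : ℤ) * G.n)) (queryGraph G S T D) := by
  have hc : (querySize * querySize).cost ≤ 100 := by decide
  refine Runs.forLoop hX (hW _ (by decide)) 3 (querySize * querySize) (hW _ (by decide))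
    (3 * S * (3 * S)) hS
    (fun k t s' => t ≤ 4000 * k + 1000 ∧ BlockState G S T D s' ∧ s'.reg 3 = (k : ℤ) ∧
      ∀ e < k, ∀ b : ℕ, b < 2 → s'.mem (2 * ((G.n : ℤ) * G.n) + 2 * e + b) =
        word b (queryWeight G S T D (e / (3 * S)) (e % (3 * S)))) ?_ ?_ ?_ ?_
  · rintro k t s' ⟨-, hf, h3, -⟩
    exact ⟨h3, by rw [eval_mul, hf.frame.eval_querySize, Nat.cast_mul (3 * S)]⟩
  · intro t ht
    exact ⟨by omega, hs.setReg (by omega) _, State.setReg_self _ _ _, fun e he => by omega⟩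
  · rintro k t s hk - ⟨ht, hf, h3, hq⟩
    refine Runs.seq (runs_storeWord hX hW hM hG hf (Nat.zero_lt_two) hk h3) ?_
    rintro t₁ _ ⟨ht₁, rfl⟩
    refine (runs_storeWord hX hW hM hG (hf.setMem ?_ _) (Nat.one_lt_two) hk h3).mono ?_
    · push_cast; omega
    rintro t₂ _ - ⟨ht₂, rfl⟩
    refine ⟨h3, fun d hd => ⟨by omega, ?_, State.setReg_self _ _ _, fun e he b hb => ?_⟩⟩
    · exact ((hf.setMem (by push_cast; omega) _).setMem (by push_cast; omega) _).setReg (by omega) _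
    · simp only [State.setReg, State.setMem, Function.update_apply]
      rcases Nat.lt_succ_iff_lt_or_eq.mp he with he | rfl
      · rw [if_neg (by omega), if_neg (by omega), hq e he b hb]
      · interval_cases b
        · rw [if_neg (by push_cast; omega), if_pos rfl]
        · rw [if_pos rfl]
  · rintro t s' - ⟨ht, hf, -, hq⟩ d hd
    refine ⟨by omega, hf, fun i j => ?_⟩
    have hi : (i : ℕ) < 3 * S := i.2
    have hj : (j : ℕ) < 3 * S := j.2
    have hS0 : 0 < 3 * S := by omega
    have hlt : (i : ℕ) * (3 * S) + j < 3 * S * (3 * S) := by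
      calc (i : ℕ) * (3 * S) + j < i * (3 * S) + 3 * S := by omega
        _ = (i + 1) * (3 * S) := by ring
        _ ≤ 3 * S * (3 * S) := Nat.mul_le_mul_right _ hi
    have h1 : ((i : ℕ) * (3 * S) + j) / (3 * S) = i := by
      rw [mul_comm, Nat.mul_add_div hS0, Nat.div_eq_of_lt hj, add_zero]
    have h2 : ((i : ℕ) * (3 * S) + j) % (3 * S) = j := by
      rw [mul_comm, Nat.mul_add_mod, Nat.mod_eq_of_lt hj]
    have q0 := hq _ hlt 0 Nat.zero_lt_two
    have q1 := hq _ hlt 1 Nat.one_lt_two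
    rw [h1, h2] at q0 q1
    constructor
    · simpa [word, queryGraph] using q0
    · simpa [word, queryGraph] using q1

/-- A triple that is not a negative triangle writes the old mark back, so marks only accumulate. -/
theorem runs_markBlock (hX : 2 ≤ X) (hW : Fits X W) (hS : S * (S * S) ≤ X) {T : ℕ}
    {D : Finset ℕ} (hs : BlockState G S T D s) :
    Runs W X box markBlock s fun t s' => t ≤ 4000 * (S * (S * S) + 1) ∧
      BlockState G S T (D ∪ found G S T (S * (S * S))) s' := by
  classical
  have hc : cube.cost ≤ 100 := by decide
  refine Runs.forLoop hX (hW _ (by decide)) 3 cube (hW _ (by decide)) (S * (S * S)) hS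
    (fun k t s' => t ≤ 4000 * k + 1000 ∧ BlockState G S T (D ∪ found G S T k) s' ∧
      s'.reg 3 = (k : ℤ)) ?_ ?_ ?_ ?_
  · rintro k t s' ⟨-, hf, h3⟩
    exact ⟨h3, hf.frame.eval_cube⟩
  · intro t ht
    refine ⟨by omega, ?_, State.setReg_self _ _ _⟩
    rw [show D ∪ found G S T 0 = D by simp [found]]
    exact hs.setReg (by omega) _
  · rintro k t s hk - ⟨ht, hf, h3⟩
    obtain ⟨e1, e2⟩ := hf.frame.eval_newMark hf.block h3 hf.marks
    have hb : newMark.cost ≤ 1500 := by decide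
    have hb' : (lit (-1) - corner 0).cost ≤ 1500 := by decide
    refine Runs.put hX _ _ (hW _ (by decide)) (hW _ (by decide)) ?_ fun t' ht' => ⟨h3, fun d hd =>
      ⟨by omega, ?_, State.setReg_self _ _ _⟩⟩
    · rw [e2]
      have : (1 : ℤ) ≤ X := by exact_mod_cast (by omega : 1 ≤ X)
      split_ifs <;> simp [this]
    · refine BlockState.setReg ⟨hf.frame.setMem (.inl ?_) _, hf.block, fun v => ?_⟩ (by omega) _
      · rw [eval_sub, e1, eval_lit]; omega
      · rw [eval_sub, e1, e2, eval_lit]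
        simp only [State.setMem, Function.update_apply]
        by_cases hv : v = vert S T 0 (dig S 0 k)
        · subst hv
          rw [if_pos rfl]
          refine if_congr ?_ rfl rfl
          simp only [Finset.mem_union, mem_found]
          constructor
          · rintro (h | h | ⟨f, hf, h⟩)
            exacts [.inr ⟨k, by omega, h, rfl⟩, .inl h, .inr ⟨f, by omega, h⟩]
          · rintro (h | ⟨f, hf, h, h'⟩)
            · exact .inr (.inl h)
            · rcases Nat.lt_succ_iff_lt_or_eq.mp hf with hf | rfl
              exacts [.inr (.inr ⟨f, hf, h, h'⟩), .inl h]
        · rw [if_neg (by omega), hf.marks]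
          refine if_congr ?_ rfl rfl
          simp only [Finset.mem_union, mem_found]
          refine or_congr Iff.rfl ⟨fun ⟨f, hf, h⟩ => ⟨f, by omega, h⟩, fun ⟨f, hf, h, h'⟩ => ?_⟩
          rcases Nat.lt_succ_iff_lt_or_eq.mp hf with hf | rfl
          exacts [⟨f, hf, h, h'⟩, absurd h'.symm hv]
  · rintro t s' - ⟨ht, hf, -⟩ d hd
    exact ⟨by omega, hf⟩

/-- The black box answers the queries within time `τ`. -/
def AnswersWithin (box : Behaviour) (G : WGraph) (S τ : ℕ) : Prop :=
  ∀ T D, ∃ t z, box (queryGraph G S T D) t z ∧ NegativeTriangle (queryGraph G S T D) z ∧ t ≤ τ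

/-- Amortized accounting: each marked vertex is worth the cost of one exhaustive search, so the
increase of `D.card` pays for the search after a YES. -/
theorem runs_processBlock (hX : 2 ≤ X) (hW : Fits X W) {M : ℕ} (hM : M ≤ X)
    (hG : G.WeightsBounded M) (hS : 3 * S * (3 * S) ≤ X) (hS' : S * (S * S) ≤ X) {τ : ℕ}
    (hbox : AnswersWithin box G S τ) {T : ℕ} {D : Finset ℕ} (hs : BlockState G S T D s) :
    Runs W X box processBlock s fun t s' => ∃ D', BlockState G S T D' s' ∧
      D' ⊆ D ∪ found G S T (S * (S * S)) ∧ D ⊆ D' ∧ found G S T (S * (S * S)) ⊆ D' ∧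
      t + D.card * (4000 * (S * (S * S) + 1)) ≤
        (4002 * (3 * S * (3 * S)) + τ + 5000) + D'.card * (4000 * (S * (S * S) + 1)) := by
  have c1 : querySize.cost ≤ 100 := by decide
  have c2 : queryAddress.cost ≤ 100 := by decide
  have c3 : (lit 0).cost + (var 4).cost ≤ 100 := by decide
  refine Runs.seq (runs_buildQuery hX hW hM hG hS hs) ?_
  rintro t₁ s₁ ⟨ht₁, hs₁, hst⟩
  obtain ⟨tb, z, hb, hz, htb⟩ := hbox T D
  have hX1 : (1 : ℤ) ≤ X := by exact_mod_cast (by omega : 1 ≤ X)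
  refine Runs.seq (R := fun t s' => t ≤ τ + 2 * (3 * S * (3 * S)) + 300 ∧ BlockState G S T D s' ∧
    s'.reg 4 = z) (Runs.ask hX ((pow_one X).symm.le.trans (hW _ (by omega))) 4 _ _
      (hW _ (by decide)) (hW _ (by decide)) (queryGraph G S T D) hs₁.frame.eval_querySize
      (by rw [hs₁.frame.eval_queryAddress]; exact hst) hb ?_
      fun d hd => ⟨?_, hs₁.setReg (by omega) _, State.setReg_self _ _ _⟩) ?_
  · rcases hz with ⟨rfl, -⟩ | ⟨rfl, -⟩ <;> simp [hX1]
  · simp only [queryGraph, sq] at hd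
    omega
  rintro t₂ s₂ ⟨ht₂, hs₂, h4⟩
  have hex := queryGraph_exists_iff (G := G) (S := S) (T := T) (D := D)
  refine Runs.when hX _ _ (hW _ (by decide)) (hW _ (by decide)) (fun h => ?_) (fun h t ht => ?_)
  · rw [eval_lit, eval_var, h4] at h
    obtain ⟨f, hf, hfD, hft⟩ := hex.mp (by
      rcases hz with ⟨-, hz⟩ | ⟨rfl, -⟩
      · exact hz
      · exact absurd h (lt_irrefl _))
    refine (runs_markBlock hX hW hS' hs₂).mono ?_
    rintro t₃ s₃ - ⟨ht₃, hs₃⟩ d hd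
    refine ⟨_, hs₃, subset_rfl, Finset.subset_union_left, Finset.subset_union_right, ?_⟩
    -- The YES provides a first corner outside of `D`, which the search marks.
    have hlt : D.card < (D ∪ found G S T (S * (S * S))).card :=
      Finset.card_lt_card (Finset.ssubset_iff_subset_ne.mpr ⟨Finset.subset_union_left, fun he =>
        hfD (he ▸ Finset.mem_union_right _ (mem_found.mpr ⟨f, hf, hft, rfl⟩))⟩)
    have := Nat.mul_le_mul_right (4000 * (S * (S * S) + 1)) hlt
    rw [Nat.succ_mul] at this
    omega
  · rw [eval_lit, eval_var, h4] at h
    have hno : ¬ ∃ v, (queryGraph G S T D).InNegativeTriangle v := by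
      rcases hz with ⟨rfl, -⟩ | ⟨-, hz⟩
      · exact absurd Int.zero_lt_one h
      · exact hz
    -- After a NO every first corner in these blocks is already in `D`; otherwise it would give a
    -- negative triangle in the query.
    refine ⟨D, hs₂, Finset.subset_union_left, subset_rfl, fun v hv => ?_, by omega⟩
    obtain ⟨f, hf, hft, rfl⟩ := mem_found.mp hv
    by_contra hfD
    exact hno (hex.mpr ⟨f, hf, hfD, hft⟩)

theorem runs_processBlocks (hX : 2 ≤ X) (hW : Fits X W) {M : ℕ} (hM : M ≤ X)
    (hG : G.WeightsBounded M) (hS : 3 * S * (3 * S) ≤ X) (hS' : S * (S * S) ≤ X)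
    (hn : G.n ≤ S * S) {τ : ℕ} (hbox : AnswersWithin box G S τ) (hs : Frame G S s)
    (hm : Marks ∅ s) :
    Runs W X box (.forLoop 2 cube processBlock) s fun t s' => ∃ D, Frame G S s' ∧ Marks D s' ∧
      (∀ v, v ∈ D ↔ ∃ a b, G.NegTri v a b) ∧
      t ≤ 200 + S * (S * S) * (4002 * (3 * S * (3 * S)) + τ + 6000) +
        G.n * (4000 * (S * (S * S) + 1)) := by
  have hc : cube.cost ≤ 100 := by decide
  refine Runs.forLoop hX (hW _ (by decide)) 2 cube (hW _ (by decide)) (S * (S * S)) hS'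
    (fun k t s' => ∃ D, BlockState G S k D s' ∧ (∀ v ∈ D, ∃ a b, G.NegTri v a b) ∧
      (∀ T < k, found G S T (S * (S * S)) ⊆ D) ∧
      t ≤ 110 + k * (4002 * (3 * S * (3 * S)) + τ + 6000) + D.card * (4000 * (S * (S * S) + 1)))
    ?_ ?_ ?_ ?_
  · rintro k t s' ⟨D, hf, -⟩
    exact ⟨hf.block, hf.frame.eval_cube⟩
  · intro t ht
    exact ⟨∅, ⟨hs.setReg le_rfl _, State.setReg_self _ _ _, hm⟩, by simp, fun T hT => absurd hT (Nat.not_lt_zero T),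
      by rw [Finset.card_empty, zero_mul, zero_mul]; omega⟩
  · rintro k t s hk - ⟨D, hf, hD, hF, ht⟩
    refine (runs_processBlock hX hW hM hG hS hS' hbox hf).mono ?_
    rintro t' s' - ⟨D', hf', h1, h2, h3, ht'⟩
    refine ⟨hf'.block, fun d hd => ⟨D', ⟨hf'.frame.setReg le_rfl _, State.setReg_self _ _ _,
      hf'.marks⟩, fun v hv => ?_, fun T hT => ?_, ?_⟩⟩
    · rcases Finset.mem_union.mp (h1 hv) with hv | hv
      · exact hD v hv
      · obtain ⟨f, -, hf, rfl⟩ := mem_found.mp hv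
        exact ⟨_, _, hf⟩
    · rcases Nat.lt_succ_iff_lt_or_eq.mp hT with hT | rfl
      exacts [(hF T hT).trans h2, h3]
    · rw [Nat.succ_mul]
      omega
  · rintro t s' - ⟨D, hf, hD, hF, ht⟩ d hd
    refine ⟨D, hf.frame, hf.marks, fun v => ⟨hD v, ?_⟩, ?_⟩
    · rintro ⟨a, b, h⟩
      obtain ⟨T, hT, f, hf, rfl, h'⟩ := h.exists_blockTri hn
      exact hF T hT (mem_found.mpr ⟨f, hf, h', rfl⟩)
    -- Block positions may exceed `n`, but marked ones lie in negative triangles and hence are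
    -- vertices.
    · have hcard : D.card ≤ G.n := by
        have : D ⊆ Finset.range G.n := fun v hv => by
          obtain ⟨a, b, h⟩ := hD v hv
          exact Finset.mem_range.mpr h.lt.1
        simpa using Finset.card_le_card this
      have := Nat.mul_le_mul_right (4000 * (S * (S * S) + 1)) hcard
      omega

theorem runs_findUnmarked (hX : 2 ≤ X) (hW : Fits X W) (hn : G.n ≤ X) {D : Finset ℕ}
    (hs : Frame G S s) (hm : Marks D s) :
    Runs W X box findUnmarked s fun t s' => t ≤ 2000 * (G.n + 1) ∧
      ((s'.reg 0 = -1 ∧ ∀ v < G.n, v ∈ D) ∨ ∃ v < G.n, s'.reg 0 = (v : ℤ) ∧ v ∉ D) := by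
  have hX1 : (1 : ℤ) ≤ X := by exact_mod_cast (by omega : 1 ≤ X)
  have c1 : (ite (mark (var 3)) (lit 1) (var 3) (var 4)).cost ≤ 100 := by decide
  refine Runs.seq (R := fun t s' => t ≤ 100 ∧ s' = s.setReg 4 (-1)) (Runs.assign hX _ _
    (hW _ (by decide)) (by simpa using hX1) fun t ht => ⟨ht.trans (by decide), rfl⟩) ?_
  rintro t₁ _ ⟨ht₁, rfl⟩
  refine Runs.seq (R := fun t s' => t ≤ 2000 * G.n + 200 ∧ s'.Bounded X ∧
    ((s'.reg 4 = -1 ∧ ∀ v < G.n, v ∈ D) ∨ ∃ v < G.n, s'.reg 4 = (v : ℤ) ∧ v ∉ D))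
    (Runs.forLoop hX (hW _ (by decide)) 3 (var 0) (hW _ (by decide)) G.n hn
    (fun k t s' => t ≤ 2000 * k + 100 ∧ Frame G S s' ∧ Marks D s' ∧ s'.reg 3 = (k : ℤ) ∧
      ((s'.reg 4 = -1 ∧ ∀ v < k, v ∈ D) ∨ ∃ v < k, s'.reg 4 = (v : ℤ) ∧ v ∉ D))
    ?_ ?_ ?_ ?_) ?_
  · rintro k t s' ⟨-, hf, -, h3, -⟩
    exact ⟨h3, hf.size⟩
  · intro t ht
    simp only [cost] at ht
    exact ⟨by omega, (hs.setReg (by omega) _).setReg (by omega) _, hm, State.setReg_self _ _ _,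
      .inl ⟨rfl, by simp⟩⟩
  · rintro k t s' hk hb ⟨ht, hf, hm, h3, h4⟩
    have ev : (ite (mark (var 3)) (lit 1) (var 3) (var 4)).eval s' =
        if k ∈ D then s'.reg 4 else (k : ℤ) := by
      have := hm k
      simp only [mark, eval_ite, eval_read, eval_sub, eval_lit, eval_var, h3, this]
      split_ifs <;> simp_all
    refine Runs.assign hX _ _ (hW _ (by decide)) ?_ fun t' ht' => ⟨?_, fun d hd => ?_⟩
    · rw [ev]
      split_ifs
      · exact hb.1 4
      · rw [Nat.abs_cast]; exact_mod_cast (by omega : k ≤ X)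
    · rw [State.setReg_of_ne _ (by omega), h3]
    · simp only [cost] at hd
      refine ⟨by omega, (hf.setReg (by omega) _).setReg (by omega) _, hm,
        State.setReg_self _ _ _, ?_⟩
      rw [State.setReg_of_ne _ (by omega), State.setReg_self, ev]
      split_ifs with hc
      · rcases h4 with ⟨h4, h⟩ | ⟨v, hv, h⟩
        · refine .inl ⟨h4, fun v hv => ?_⟩
          rcases Nat.lt_succ_iff_lt_or_eq.mp hv with hv | rfl
          exacts [h v hv, hc]
        · exact .inr ⟨v, by omega, h⟩
      · exact .inr ⟨k, by omega, rfl, hc⟩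
  · rintro t s' hb ⟨ht, -, -, -, h⟩ d hd
    exact ⟨by omega, hb, h⟩
  · rintro t₂ s₂ ⟨ht₂, hb, h⟩
    refine Runs.assign hX _ _ (hW _ (by decide)) (hb.1 4) fun t ht => ⟨?_, ?_⟩
    · simp only [cost] at ht
      omega
    · rw [State.setReg_self]
      exact h

end Loops


/-! ### The reduction -/

section Reduction

variable {W X : ℕ} {box : Behaviour} {G : WGraph}

theorem WGraph.initState_bounded (hX : 2 ≤ X) {M : ℕ} (hM : M ≤ X) (hn : G.n ≤ X)
    (hG : G.WeightsBounded M) : G.initState.Bounded X := by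
  have hw : ∀ b i j, |word b (G.entry i j)| ≤ (X : ℤ) := fun b i j =>
    abs_word_le hX fun x hx => (hG.entry hx).trans (by exact_mod_cast hM)
  refine ⟨fun r => ?_, fun a => ?_⟩
  · simp only [initState]
    split_ifs
    · rw [Nat.abs_cast]; exact_mod_cast hn
    · simp
  · simp only [initState, initMem]
    split_ifs
    · simp
    · exact hw 0 _ _
    · exact hw 1 _ _

theorem WGraph.initState_frame (G : WGraph) : Frame G 0 G.initState := by
  refine ⟨rfl, rfl, fun b hb u v hu hv => ?_⟩
  obtain ⟨h1, h2⟩ := G.initState_stores ⟨u, hu⟩ ⟨v, hv⟩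
  have key : G.entry u v = G.w ⟨u, hu⟩ ⟨v, hv⟩ := dif_pos ⟨hu, hv⟩
  rw [key]
  interval_cases b
  · simpa [word] using h1
  · simpa [word] using h2

theorem runs_reduction (hX : 2 ≤ X) (hW : Fits X W) {M : ℕ} (hM : M ≤ X)
    (hG : G.WeightsBounded M) (hn : 9 * (G.n + 1) ^ 3 ≤ X) {τ : ℕ → ℕ}
    (hbox : ∀ S, G.n ≤ S * S → AnswersWithin box G S (τ S)) :
    Runs W X box reduction G.initState fun t s => CoNegativeTriangle G (s.reg 0) ∧
      ∃ S, G.n ≤ S * S ∧ (S = 0 ∨ (S - 1) * (S - 1) < G.n) ∧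
        t ≤ 4000 * (G.n + 2) + 200 + S * (S * S) * (4002 * (3 * S * (3 * S)) + τ S + 6000) +
          G.n * (4000 * (S * (S * S) + 1)) := by
  -- The loop bounds `9 * S ^ 2` and `S ^ 3` must not exceed `X`; this is what `hn` is for.
  have hpow : ∀ S ≤ G.n, 3 * S * (3 * S) ≤ X ∧ S * (S * S) ≤ X := by
    intro S hS
    have h1 : S * S ≤ G.n * G.n := Nat.mul_le_mul hS hS
    have h2 : S * (S * S) ≤ G.n * (G.n * G.n) := Nat.mul_le_mul hS h1
    constructor <;> nlinarith [Nat.zero_le (G.n * (G.n * G.n)), Nat.zero_le (G.n * G.n)]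
  have hn1 : G.n + 1 ≤ X := by
    nlinarith [Nat.zero_le (G.n * (G.n * G.n)), Nat.zero_le (G.n * G.n)]
  refine Runs.seq (runs_findSide hX hW hn1 G.initState_frame) ?_
  rintro t₁ s₁ ⟨ht₁, hm, S, hf, hS, hSn, hS'⟩
  have hm₁ : Marks ∅ s₁ := by
    intro v
    -- Negative addresses hold `0` at the start, so the marks need no initialization.
    have : (-1 - (v : ℤ)) < 0 := by omega
    simp [hm, WGraph.initState, WGraph.initMem, this]
  refine Runs.seq (runs_processBlocks hX hW hM hG (hpow S hSn).1 (hpow S hSn).2 hS (hbox S hS) hf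
    hm₁) ?_
  rintro t₂ s₂ ⟨D, hf₂, hm₂, hD, ht₂⟩
  refine (runs_findUnmarked hX hW (by omega) hf₂ hm₂).mono ?_
  rintro t₃ s₃ - ⟨ht₃, h⟩
  refine ⟨?_, S, hS, hS', by omega⟩
  rcases h with ⟨h, hv⟩ | ⟨v, hv, h, hvD⟩
  · exact .inl ⟨h, fun v => (G.inNegativeTriangle_iff v).mpr ((hD v).mp (hv v v.2))⟩
  · exact .inr ⟨⟨v, hv⟩, h, fun hneg =>
      hvD ((hD v).mpr ((G.inNegativeTriangle_iff ⟨v, hv⟩).mp hneg))⟩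

end Reduction

/-! ### From powers of `S` to powers of `n` -/

theorem time_le_pow {n S τ t : ℕ} (hS : n ≤ S * S)
    (ht : t ≤ 4000 * (n + 2) + 200 + S * (S * S) * (4002 * (3 * S * (3 * S)) + τ + 6000) +
      n * (4000 * (S * (S * S) + 1))) :
    t ≤ 100000 * (S + 1) ^ 5 + (S + 1) ^ 3 * τ := by
  have h1 : n * (4000 * (S * (S * S) + 1)) ≤ S * S * (4000 * (S * (S * S) + 1)) :=
    Nat.mul_le_mul_right _ hS
  have h2 : S * (S * S) * τ ≤ (S + 1) ^ 3 * τ :=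
    Nat.mul_le_mul_right _ (by ring_nf; omega)
  have h3 : 4000 * (S * S + 2) + 200 + S * (S * S) * (4002 * (3 * S * (3 * S)) + 6000) +
      S * S * (4000 * (S * (S * S) + 1)) ≤ 100000 * (S + 1) ^ 5 := by
    ring_nf; omega
  have h4 : S * (S * S) * (4002 * (3 * S * (3 * S)) + τ + 6000) =
      S * (S * S) * (4002 * (3 * S * (3 * S)) + 6000) + S * (S * S) * τ := by ring
  omega

theorem sq_succ_le {n S : ℕ} (hS : S = 0 ∨ (S - 1) * (S - 1) < n) : (S + 1) ^ 2 ≤ 9 * (n + 1) := by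
  rcases S with - | S
  · omega
  · have h : S * S < n := by simpa using hS
    nlinarith [mul_self_nonneg ((S : ℤ) - 1)]

/-- With `Y = S + 1`, the bound `e ≤ 1` gives `Y ^ 5 ≤ Y ^ (6 - e)`, and `Y ^ 2 ≤ 9 * (n + 1)`
halves the exponent. The constants are `27 = 3 ^ 3`, from `3 * S + 1 ≤ 3 * Y`, and `729 = 9 ^ 3`. -/
theorem time_le_rpow {n S τ t : ℕ} {C e : ℝ} (hC : 0 ≤ C) (he0 : 0 < e) (he1 : e ≤ 1)
    (hS : S = 0 ∨ (S - 1) * (S - 1) < n) (hτ : (τ : ℝ) ≤ C * (3 * (S : ℝ) + 1) ^ (3 - e))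
    (ht : t ≤ 100000 * (S + 1) ^ 5 + (S + 1) ^ 3 * τ) :
    (t : ℝ) ≤ 729 * (100000 + 27 * C) * ((n : ℝ) + 1) ^ (3 - e / 2) := by
  set Y : ℝ := (S : ℝ) + 1 with hY
  have hY1 : 1 ≤ Y := by rw [hY]; linarith [(Nat.cast_nonneg S : (0 : ℝ) ≤ S)]
  have hY0 : 0 < Y := by linarith
  have hN : (0 : ℝ) < (n : ℝ) + 1 := by positivity
  have h5 : Y ^ 5 ≤ Y ^ (6 - e) := by
    rw [← Real.rpow_natCast]
    exact Real.rpow_le_rpow_of_exponent_le hY1 (by push_cast; linarith)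
  have h27 : (3 : ℝ) ^ (3 - e) ≤ 27 := by
    calc (3 : ℝ) ^ (3 - e) ≤ 3 ^ (3 : ℝ) :=
          Real.rpow_le_rpow_of_exponent_le (by norm_num) (by linarith)
      _ = 27 := by norm_num
  have h3 : Y ^ 3 * (τ : ℝ) ≤ 27 * C * Y ^ (6 - e) := by
    have h : (3 * (S : ℝ) + 1) ^ (3 - e) ≤ 27 * Y ^ (3 - e) := by
      calc (3 * (S : ℝ) + 1) ^ (3 - e) ≤ (3 * Y) ^ (3 - e) :=
            Real.rpow_le_rpow (by positivity) (by rw [hY]; linarith) (by linarith)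
        _ = 3 ^ (3 - e) * Y ^ (3 - e) := Real.mul_rpow (by norm_num) hY0.le
        _ ≤ 27 * Y ^ (3 - e) := by gcongr
    calc Y ^ 3 * (τ : ℝ) ≤ Y ^ 3 * (C * (27 * Y ^ (3 - e))) := by
          gcongr
          exact hτ.trans (by gcongr)
      _ = 27 * C * (Y ^ (3 : ℝ) * Y ^ (3 - e)) := by
          rw [show (3 : ℝ) = ((3 : ℕ) : ℝ) by norm_num, Real.rpow_natCast]; push_cast; ring
      _ = 27 * C * Y ^ (6 - e) := by
          rw [← Real.rpow_add hY0]; ring_nf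
  have hYN : Y ^ (6 - e) ≤ 729 * ((n : ℝ) + 1) ^ (3 - e / 2) := by
    have hsq : Y ^ 2 ≤ 9 * ((n : ℝ) + 1) := by rw [hY]; exact_mod_cast sq_succ_le hS
    calc Y ^ (6 - e) = (Y ^ (2 : ℕ)) ^ (3 - e / 2) := by
          rw [← Real.rpow_natCast, ← Real.rpow_mul hY0.le]; push_cast; ring_nf
      _ ≤ (9 * ((n : ℝ) + 1)) ^ (3 - e / 2) :=
          Real.rpow_le_rpow (by positivity) hsq (by linarith)
      _ = 9 ^ (3 - e / 2) * ((n : ℝ) + 1) ^ (3 - e / 2) := Real.mul_rpow (by norm_num) hN.le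
      _ ≤ 9 ^ (3 : ℝ) * ((n : ℝ) + 1) ^ (3 - e / 2) := by
          gcongr
          · norm_num
          · linarith
      _ = 729 * ((n : ℝ) + 1) ^ (3 - e / 2) := by norm_num
  have ht' : (t : ℝ) ≤ 100000 * Y ^ 5 + Y ^ 3 * τ := by rw [hY]; exact_mod_cast ht
  calc (t : ℝ) ≤ (100000 + 27 * C) * Y ^ (6 - e) := by linarith
    _ ≤ (100000 + 27 * C) * (729 * ((n : ℝ) + 1) ^ (3 - e / 2)) := by gcongr
    _ = _ := by ring

theorem answersWithin_floor {box : Behaviour} {G : WGraph} {S c : ℕ} {C ε e : ℝ} (heε : e ≤ ε)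
    (hC : ∀ H : WGraph, H.WeightsBounded (H.n ^ (2 * c)) →
      ∃ t z, box H t z ∧ NegativeTriangle H z ∧ (t : ℝ) ≤ C * ((H.n : ℝ) + 1) ^ (3 - ε))
    (hG : G.WeightsBounded (G.n ^ c)) (hS : G.n ≤ S * S) :
    AnswersWithin box G S ⌊|C| * (3 * (S : ℝ) + 1) ^ (3 - e)⌋₊ := by
  intro T D
  -- A query has only about `√n` vertices, so its weights, copied from `G`, need twice the exponent.
  have hpow : G.n ^ c ≤ (3 * S) ^ (2 * c) := by
    rw [pow_mul]
    exact Nat.pow_le_pow_left (by nlinarith) c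
  obtain ⟨t, z, h1, h2, h3⟩ := hC (queryGraph G S T D) fun i j x hx =>
    (queryGraph_weightsBounded hG i j x hx).trans (by exact_mod_cast hpow)
  refine ⟨t, z, h1, h2, Nat.le_floor (h3.trans ?_)⟩
  have hb : ((queryGraph G S T D).n : ℝ) + 1 = 3 * (S : ℝ) + 1 := by simp [queryGraph]
  rw [hb]
  have h1S : (1 : ℝ) ≤ 3 * (S : ℝ) + 1 := by linarith [(Nat.cast_nonneg S : (0 : ℝ) ≤ S)]
  calc C * (3 * (S : ℝ) + 1) ^ (3 - ε) ≤ |C| * (3 * (S : ℝ) + 1) ^ (3 - ε) := by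
        gcongr
        exact le_abs_self C
    _ ≤ |C| * (3 * (S : ℝ) + 1) ^ (3 - e) := by
        gcongr

theorem subcubicReduction_coNegativeTriangle :
    SubcubicReduction CoNegativeTriangle NegativeTriangle := by
  -- Take `X = (n + 2) ^ (c + 6)`, which bounds the weights and `9 * (n + 1) ^ 3`; the factor `1000`
  -- is the bound on degrees in `Fits`. Replacing `ε` by `min ε 1` lets the `S ^ 5` term be
  -- absorbed.
  refine ⟨reduction, fun c => ⟨2 * c, (c + 6) * 1000, fun ε hε => ⟨min ε 1 / 2,
    by positivity, ?_⟩⟩⟩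
  rintro box - ⟨C, hC⟩
  refine ⟨729 * (100000 + 27 * |C|), fun G hG => ?_⟩
  have hX : 2 ≤ (G.n + 2) ^ (c + 6) :=
    (Nat.le_add_left 2 G.n).trans (Nat.le_self_pow (by omega) _)
  have hM : G.n ^ c ≤ (G.n + 2) ^ (c + 6) :=
    (Nat.pow_le_pow_left (by omega) c).trans (Nat.pow_le_pow_right (by omega) (by omega))
  have hn : 9 * (G.n + 1) ^ 3 ≤ (G.n + 2) ^ (c + 6) := by
    refine le_trans ?_ (Nat.pow_le_pow_right (by omega) (by omega : 6 ≤ c + 6))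
    ring_nf
    omega
  have hW : Fits ((G.n + 2) ^ (c + 6)) ((G.n + 2) ^ ((c + 6) * 1000)) := fun d hd => by
    rw [← pow_mul]
    exact Nat.pow_le_pow_right (by omega) (Nat.mul_le_mul_left _ hd)
  have hnX : G.n ≤ (G.n + 2) ^ (c + 6) :=
    (Nat.le_add_right _ 2).trans (Nat.le_self_pow (by omega) _)
  obtain ⟨t, σ, s, hex, hσ, -, hans, S, hS, hS', ht⟩ :=
    runs_reduction hX hW hM hG hn (fun S hS => answersWithin_floor (min_le_left ε 1) hC hG hS)
      (G.initState_bounded hX hM hnX hG) G.initState ⟨rfl, fun r => by simp [WGraph.initState]⟩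
  refine ⟨t, s.reg 0, ⟨σ, hex, hσ.2 0⟩, hans, ?_⟩
  exact time_le_rpow (abs_nonneg C) (lt_min hε one_pos) (min_le_right _ _) hS'
    (Nat.floor_le (by positivity)) (time_le_pow hS ht)

end Subcubic

theorem theorem1p5 :
    Subcubic.SubcubicReduction Subcubic.CoNegativeTriangle Subcubic.NegativeTriangle :=
  Subcubic.subcubicReduction_coNegativeTriangle
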